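/- A star $b$-matching game is given by a star $G$ with centre $u$ and leaves $v_1,\dots,v_n$ ($n\ge 0$), nonnegative weights $w_i$ on the edges $(u,v_i)$, and vertex capacities $b_u,b_1,\dots,b_n\in\mathbb Z_{\ge 0}$. The agents are the vertices, and the worth $\nu(S)$ of a set $S$ of agents is the maximum weight of a $b$-matching in $G$ restricted to $S$, i.e. of a choice of edges with multiplicity (each edge may be used any number of times) in which no vertex is used more often than its capacity. We write $\nu(G)$ for the worth of the set of all agents and $\nu(G\setminus\{v_i\})$ for the worth of all agents except $v_i$. An imputation is a nonnegative profit share $p$ on the agents with total $\nu(G)$; it is in the core if $\sum_{a\in S}p(a)\ge\nu(S)$ for every set $S$ of agents. There is a strongly polynomial-time algorithm which, given a star $b$-matching game and an imputation $p$, decides whether $p$ is in the core. More precisely, there are a single random access machine program (whose operations on data are $+,-,\times$, comparison and loading natural-number constants) and polynomials $q,r$ such that: 1. On every input with real $w$ and $p$, the program halts after at most $q(n)$ steps, and its output consists of the correct answer to the question whether $p$ is in the core, together with $\nu(G)$ and $\nu(G\setminus\{v_i\})$ for every leaf $v_i$. Moreover $p$ is in the core if and only if $p(v_i)\le \nu(G)-\nu(G\setminus\{v_i\})$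 for every leaf $v_i$. 2. On every input with rational $w$ and $p$, the program, run over $\mathbb Q$, halts with this same correct output after at most $q(n)$ steps, and its total running time under the logarithmic cost criterion (each step is charged one plus the binary lengths of all numbers and addresses that it reads or writes) is at most $r(L)$, where $L$ is the total binary encoding length of $b$, $w$ and $p$. -/

import Mathlib

/-! ## Cooperative games -/

/-- An imputation of the game with characteristic function `ν`: a nonnegative profit share that
distributes exactly the worth of the grand coalition. -/
def IsImputation {N : Type*} [Fintype N] (ν : Finset N → ℝ) (p : N → ℝ) : Prop :=
  (∀ i, 0 ≤ p i) ∧ ∑ i, p i = ν Finset.univ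

/-- The core: the imputations under which every sub-coalition receives at least its worth. -/
def gameCore {N : Type*} [Fintype N] (ν : Finset N → ℝ) : Set (N → ℝ) :=
  {p | IsImputation ν p ∧ ∀ S : Finset N, ν S ≤ ∑ i ∈ S, p i}

/-- The marginal utility of agent `i`: the decrease in worth when `i` is excluded. -/
def marginalUtility {N : Type*} [Fintype N] [DecidableEq N] (ν : Finset N → ℝ) (i : N) : ℝ :=
  ν Finset.univ - ν (Finset.univ.erase i)

/-! ## Bipartite `b`-matching games -/

/-- A bipartite graph with vertex classes `U` and `V`, edge weights and vertex capacities. -/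
structure BipartiteInstance (U V : Type*) where
  edges : Finset (U × V)
  weight : U × V → ℝ
  cap : U ⊕ V → ℕ

namespace BipartiteInstance

variable {U V : Type*} [Fintype U] [Fintype V]

/-- `x` (the multiplicity with which each edge is chosen) is a `b`-matching of the graph
restricted to the vertices in `S`. An edge may be used any number of times, subject only to the
vertex capacities. -/
def IsBMatching (G : BipartiteInstance U V) (S : Finset (U ⊕ V)) (x : U × V → ℕ) : Prop :=
  (∀ e, x e ≠ 0 → e ∈ G.edges ∧ Sum.inl e.1 ∈ S ∧ Sum.inr e.2 ∈ S) ∧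
  (∀ u, ∑ v, x (u, v) ≤ G.cap (Sum.inl u)) ∧
  (∀ v, ∑ u, x (u, v) ≤ G.cap (Sum.inr v))

/-- The total weight of a choice of edges with multiplicity. -/
def totalWeight (G : BipartiteInstance U V) (x : U × V → ℕ) : ℝ :=
  ∑ e, (x e : ℝ) * G.weight e

/-- The worth `ν(S)` of a coalition: the largest weight of a `b`-matching within `S`. The supremum
is attained, see `isGreatest_worth`. -/
noncomputable def worth (G : BipartiteInstance U V) (S : Finset (U ⊕ V)) : ℝ :=
  sSup (G.totalWeight '' {x | G.IsBMatching S x})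

theorem finite_isBMatching (G : BipartiteInstance U V) (S : Finset (U ⊕ V)) :
    {x | G.IsBMatching S x}.Finite := by
  refine (Set.Finite.pi' fun e : U × V => Set.finite_Iic (G.cap (Sum.inl e.1))).subset ?_
  intro x hx e
  exact (Finset.single_le_sum (f := fun v => x (e.1, v)) (fun _ _ => Nat.zero_le _)
    (Finset.mem_univ e.2)).trans (hx.2.1 e.1)

theorem isBMatching_zero (G : BipartiteInstance U V) (S : Finset (U ⊕ V)) :
    G.IsBMatching S 0 := by
  refine ⟨fun e he => absurd rfl he, fun u => ?_, fun v => ?_⟩ <;> simp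

theorem isGreatest_worth (G : BipartiteInstance U V) (S : Finset (U ⊕ V)) :
    IsGreatest (G.totalWeight '' {x | G.IsBMatching S x}) (G.worth S) := by
  have hf := (G.finite_isBMatching S).image G.totalWeight
  have hne : (G.totalWeight '' {x | G.IsBMatching S x}).Nonempty :=
    ⟨_, 0, G.isBMatching_zero S, rfl⟩
  exact ⟨hne.csSup_mem hf, fun _ ht => le_csSup hf.bddAbove ht⟩

end BipartiteInstance

/-- The star with centre `u = Sum.inl ()`, leaves `v_i = Sum.inr i` for `i : Fin n`, all edges
`(u, v_i)`, weight `w i` on the edge `(u, v_i)` and capacities `b`. -/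
def starGraph (n : ℕ) (w : Fin n → ℝ) (b : Unit ⊕ Fin n → ℕ) : BipartiteInstance Unit (Fin n) where
  edges := Finset.univ
  weight := fun e => w e.2
  cap := b

/-! ## A random access machine

The machine has index registers `I[0], I[1], …` holding natural numbers and a data memory
`M[0], M[1], …` holding elements of an ordered ring `K`, which is addressed indirectly through the
index registers. Programs are finite and do not depend on `K`. The only operations on data are
`+`, `-`, `*`, comparison, and loading a natural number constant; there is no division, no rounding
and no transfer from data to indices other than through comparisons. Since the program text is
structured, the control state is the stack of statements still to be executed. -/

namespace RAM

/-- The contents of the index registers and of the data memory. -/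
structure Store (K : Type*) where
  idx : ℕ → ℕ
  mem : ℕ → K

/-- Tests; `dataLe i j` compares `M[I[i]]` with `M[I[j]]`. -/
inductive Test where
  | idxLe (i j : ℕ)
  | idxLt (i j : ℕ)
  | dataLe (i j : ℕ)
  | dataLt (i j : ℕ)

/-- Programs.
* `idxConst i c`: `I[i] := c`
* `idxAdd i j k`: `I[i] := I[j] + I[k]`
* `idxSub i j k`: `I[i] := I[j] - I[k]` (truncated at `0`)
* `dataConst i c`: `M[I[i]] := c`
* `dataAdd i j k`: `M[I[i]] := M[I[j]] + M[I[k]]`, and likewise `dataSub`, `dataMul`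
* `loop t P`: while `t` holds, execute `P`. -/
inductive Prog where
  | skip
  | seq (P Q : Prog)
  | ite (t : Test) (P Q : Prog)
  | loop (t : Test) (P : Prog)
  | idxConst (i c : ℕ)
  | idxAdd (i j k : ℕ)
  | idxSub (i j k : ℕ)
  | dataConst (i c : ℕ)
  | dataAdd (i j k : ℕ)
  | dataSub (i j k : ℕ)
  | dataMul (i j k : ℕ)

section Semantics

variable {K : Type*}

/-- `I[i] := c`. -/
def Store.setIdx (s : Store K) (i c : ℕ) : Store K :=
  { s with idx := Function.update s.idx i c }

/-- `M[I[i]] := x`. -/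
def Store.setMem (s : Store K) (i : ℕ) (x : K) : Store K :=
  { s with mem := Function.update s.mem (s.idx i) x }

/-- The content of `M[I[i]]`. -/
def Store.get (s : Store K) (i : ℕ) : K := s.mem (s.idx i)

/-- The truth value of a test. -/
def Test.eval [LinearOrder K] (s : Store K) : Test → Bool
  | .idxLe i j => decide (s.idx i ≤ s.idx j)
  | .idxLt i j => decide (s.idx i < s.idx j)
  | .dataLe i j => decide (s.get i ≤ s.get j)
  | .dataLt i j => decide (s.get i < s.get j)

/-- A configuration: the stack of statements still to be executed, and the store. -/
structure Config (K : Type*) where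
  todo : List Prog
  store : Store K

/-- One step of the machine. A configuration with nothing left to execute is halted. -/
def step [CommRing K] [LinearOrder K] (c : Config K) : Config K :=
  let s := c.store
  match c.todo with
  | [] => c
  | .skip :: r => ⟨r, s⟩
  | .seq P Q :: r => ⟨P :: Q :: r, s⟩
  | .ite t P Q :: r => ⟨(if t.eval s then P else Q) :: r, s⟩
  | .loop t P :: r => if t.eval s then ⟨P :: .loop t P :: r, s⟩ else ⟨r, s⟩
  | .idxConst i a :: r => ⟨r, s.setIdx i a⟩
  | .idxAdd i j k :: r => ⟨r, s.setIdx i (s.idx j + s.idx k)⟩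
  | .idxSub i j k :: r => ⟨r, s.setIdx i (s.idx j - s.idx k)⟩
  | .dataConst i a :: r => ⟨r, s.setMem i (a : K)⟩
  | .dataAdd i j k :: r => ⟨r, s.setMem i (s.get j + s.get k)⟩
  | .dataSub i j k :: r => ⟨r, s.setMem i (s.get j - s.get k)⟩
  | .dataMul i j k :: r => ⟨r, s.setMem i (s.get j * s.get k)⟩

/-- The configuration after `t` steps of the program `P` started on the store `s`. -/
def run [CommRing K] [LinearOrder K] (P : Prog) (s : Store K) (t : ℕ) : Config K :=
  step^[t] ⟨[P], s⟩

/-- The program `P` started on the store `s` has halted after `t` steps. -/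
def HaltedAt [CommRing K] [LinearOrder K] (P : Prog) (s : Store K) (t : ℕ) : Prop :=
  (run P s t).todo = []

end Semantics

/-! ### Bit costs, for data in `ℚ` -/

/-- The binary encoding length of a rational number: sign, numerator and denominator. -/
def ratSize (x : ℚ) : ℕ := 1 + x.num.natAbs.size + x.den.size

/-- The bits of the index register `I[i]`. -/
def idxBits (s : Store ℚ) (i : ℕ) : ℕ := (s.idx i).size

/-- The bits of the data cell `M[I[i]]`, together with the bits of its address. -/
def cellBits (s : Store ℚ) (i : ℕ) : ℕ := idxBits s i + ratSize (s.get i)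

/-- The bits of the two operands of a test. -/
def Test.bits (s : Store ℚ) : Test → ℕ
  | .idxLe i j => idxBits s i + idxBits s j
  | .idxLt i j => idxBits s i + idxBits s j
  | .dataLe i j => cellBits s i + cellBits s j
  | .dataLt i j => cellBits s i + cellBits s j

/-- The logarithmic cost of the next step: one plus the encoding lengths of all the operands, of
the result, and of all the addresses involved. -/
def stepCost (c : Config ℚ) : ℕ :=
  let s := c.store
  match c.todo with
  | [] => 0
  | .skip :: _ => 1
  | .seq _ _ :: _ => 1
  | .ite t _ _ :: _ => 1 + t.bits s
  | .loop t _ :: _ => 1 + t.bits s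
  | .idxConst _ a :: _ => 1 + a.size
  | .idxAdd _ j k :: _ => 1 + idxBits s j + idxBits s k + (s.idx j + s.idx k).size
  | .idxSub _ j k :: _ => 1 + idxBits s j + idxBits s k + (s.idx j - s.idx k).size
  | .dataConst i a :: _ => 1 + idxBits s i + ratSize (a : ℚ)
  | .dataAdd i j k :: _ =>
      1 + cellBits s j + cellBits s k + idxBits s i + ratSize (s.get j + s.get k)
  | .dataSub i j k :: _ =>
      1 + cellBits s j + cellBits s k + idxBits s i + ratSize (s.get j - s.get k)
  | .dataMul i j k :: _ =>
      1 + cellBits s j + cellBits s k + idxBits s i + ratSize (s.get j * s.get k)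

/-- The total logarithmic cost of the first `T` steps. -/
def bitCost (P : Prog) (s : Store ℚ) (T : ℕ) : ℕ :=
  ∑ t ∈ Finset.range T, stepCost (run P s t)

end RAM

/-! ## Encoding of a star game and a profit share as input -/

/-- The initial store: `I[0] = n`, `M[0] = b_u`, `M[1] = p_u`, and
`M[2 + 3i] = w_i`, `M[3 + 3i] = b_i`, `M[4 + 3i] = p_i` for `i < n`; everything else is `0`. -/
def starInput {K : Type*} [CommRing K] (n : ℕ) (w : Fin n → K) (b : Unit ⊕ Fin n → ℕ)
    (p : Unit ⊕ Fin n → K) : RAM.Store K where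
  idx := fun i => if i = 0 then n else 0
  mem := fun a =>
    match a with
    | 0 => (b (Sum.inl ()) : K)
    | 1 => p (Sum.inl ())
    | a + 2 =>
      if h : a / 3 < n then
        match a % 3 with
        | 0 => w ⟨a / 3, h⟩
        | 1 => (b (Sum.inr ⟨a / 3, h⟩) : K)
        | _ => p (Sum.inr ⟨a / 3, h⟩)
      else 0

/-- The binary encoding length of a star game and a profit share with rational data. -/
def starInputSize (n : ℕ) (w : Fin n → ℚ) (b : Unit ⊕ Fin n → ℕ) (p : Unit ⊕ Fin n → ℚ) : ℕ :=
  RAM.ratSize (b (Sum.inl ()) : ℚ) + RAM.ratSize (p (Sum.inl ())) +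
    ∑ i, (RAM.ratSize (w i) + RAM.ratSize (b (Sum.inr i) : ℚ) + RAM.ratSize (p (Sum.inr i)))

/-- The final memory contents are right: `M[0]` is `1` if `p` is in the core and `0` otherwise,
`M[1] = ν(G)`, and `M[2 + i] = ν(G ∖ {v_i})` for every leaf `v_i`. -/
def IsCorrectOutput (n : ℕ) (w : Fin n → ℝ) (b : Unit ⊕ Fin n → ℕ) (p : Unit ⊕ Fin n → ℝ)
    (m : ℕ → ℝ) : Prop :=
  (p ∈ gameCore (starGraph n w b).worth → m 0 = 1) ∧
  (p ∉ gameCore (starGraph n w b).worth → m 0 = 0) ∧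
  m 1 = (starGraph n w b).worth Finset.univ ∧
  ∀ i : Fin n, m (2 + (i : ℕ)) = (starGraph n w b).worth (Finset.univ.erase (Sum.inr i))

/-!
The worth of a coalition that contains the centre and the leaves in `R` is given by linear
programming duality: it is the minimum over the prices `c ≥ 0` of the centre of
`c * b_u + ∑ j ∈ R, b_j * max (w_j - c) 0`, and the minimum is attained at `c = 0` or at one of the
weights (`StarGame.leafWorth_le_dualValue`, `StarGame.exists_leafWorth_eq_dualValue`). An integral
primal optimum for the critical price takes all copies of the heavier leaves and as many copies of
the leaves of exactly this weight as the centre still admits.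

The dual formula makes the worth submodular in the leaf set (`StarGame.leafWorth_submodular`), so
the joint contribution of a set of leaves to the grand coalition is at least the sum of their
marginal utilities. This is why the core conditions for single omitted leaves imply all others
(`StarGame.mem_gameCore_iff`).

The formula is also the algorithm: minimizing the dual value over the `n + 1` candidate prices, for
the whole game and for each omitted leaf, needs no sorting and `O(n ^ 3)` steps
(`RAM.terminates_starProg`). Correctness is proved over any commutative ring with a linear order, so
it applies to `ℝ` and to `ℚ` alike.

For the bit complexity it suffices that the first factor of each product is an input capacity. With
`L` the input length, all data then stay multiples of `1 / D` for a common denominator `D ≤ 2 ^ L`,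
and each step multiplies the bound on their absolute values by at most `2 ^ (L + 3)`; as there are
polynomially many steps, all binary lengths stay polynomial (`RAM.bitCost_le`).
-/

/-! ### Worth of a star coalition by linear programming duality -/

/-- A vector of natural numbers between `lo` and `hi` can be chosen with any prescribed total
between the two extreme totals. -/
theorem exists_sum_eq_of_le_of_le {ι : Type*} [Fintype ι] {lo hi : ι → ℕ}
    (h : lo ≤ hi) {T : ℕ} (hlo : ∑ i, lo i ≤ T) (hhi : T ≤ ∑ i, hi i) :
    ∃ x : ι → ℕ, lo ≤ x ∧ x ≤ hi ∧ ∑ i, x i = T := by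
  classical
  induction T, hlo using Nat.le_induction with
  | base => exact ⟨lo, le_rfl, h, rfl⟩
  | succ T _ ih =>
    obtain ⟨x, hx, hx', hT⟩ := ih (by omega)
    obtain ⟨j, -, hj⟩ : ∃ j ∈ Finset.univ, x j < hi j :=
      Finset.exists_lt_of_sum_lt (by omega)
    refine ⟨x + Pi.single j 1, fun i => (hx i).trans (by simp), fun i => ?_, ?_⟩
    · by_cases hij : i = j
      · subst hij; simpa using hj
      · simpa [hij] using hx' i
    · simp [Finset.sum_add_distrib, hT]

namespace StarGame

variable {n : ℕ} {w : Fin n → ℝ} {b : Unit ⊕ Fin n → ℕ}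

/-- The objective of the dual linear program of the star with leaf set `R` when the centre has
price `c`; the optimal price of leaf `j` is then `max (w j - c) 0`. -/
noncomputable def dualValue (w : Fin n → ℝ) (b : Unit ⊕ Fin n → ℕ) (R : Finset (Fin n)) (c : ℝ) :
    ℝ :=
  c * b (Sum.inl ()) + ∑ j ∈ R, b (Sum.inr j) * max (w j - c) 0

/-- The worth of the coalition consisting of the centre and the leaves in `R`. -/
noncomputable def leafWorth (w : Fin n → ℝ) (b : Unit ⊕ Fin n → ℕ) (R : Finset (Fin n)) : ℝ :=
  (starGraph n w b).worth (Finset.univ.disjSum R)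

theorem totalWeight_eq (x : Unit × Fin n → ℕ) :
    (starGraph n w b).totalWeight x = ∑ j, (x ((), j) : ℝ) * w j := by
  simp [BipartiteInstance.totalWeight, Fintype.sum_prod_type, starGraph]

theorem leafWorth_le_dualValue (w : Fin n → ℝ) (b : Unit ⊕ Fin n → ℕ) (R : Finset (Fin n))
    {c : ℝ} (hc : 0 ≤ c) : leafWorth w b R ≤ dualValue w b R c := by
  obtain ⟨x, ⟨hS, hu, hv⟩, hx⟩ := ((starGraph n w b).isGreatest_worth (Finset.univ.disjSum R)).1
  have hu' : ∑ j, (x ((), j) : ℝ) ≤ b (Sum.inl ()) := by exact_mod_cast hu ()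
  have hv' : ∀ j, (x ((), j) : ℝ) ≤ b (Sum.inr j) := fun j => by
    have := hv j
    simp only [Finset.univ_unique, Finset.sum_singleton] at this
    exact_mod_cast this
  have hR : ∀ j ∉ R, (x ((), j) : ℝ) = 0 := fun j hj => by
    by_contra h
    have := (hS ((), j) (by exact_mod_cast h)).2.2
    simp [hj] at this
  rw [leafWorth, ← hx, totalWeight_eq, dualValue]
  calc ∑ j, (x ((), j) : ℝ) * w j
      = ∑ j, (c * x ((), j) + x ((), j) * (w j - c)) := by
        refine Finset.sum_congr rfl fun j _ => by ring
    _ = c * ∑ j, (x ((), j) : ℝ) + ∑ j ∈ R, x ((), j) * (w j - c) := by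
        rw [Finset.sum_add_distrib, Finset.mul_sum,
          Finset.sum_subset (Finset.subset_univ R) fun j _ hj => by rw [hR j hj, zero_mul]]
    _ ≤ _ := by
        refine add_le_add (mul_le_mul_of_nonneg_left hu' hc) (Finset.sum_le_sum fun j _ => ?_)
        calc (x ((), j) : ℝ) * (w j - c) ≤ x ((), j) * max (w j - c) 0 := by
              gcongr; exact le_max_left _ _
          _ ≤ _ := mul_le_mul_of_nonneg_right (hv' j) (le_max_right _ _)

/-- The critical price `c`: the capacity of the centre suffices for all leaves of `R` heavier than
`c`, and unless `c = 0`, it is used up once the leaves of weight exactly `c` are added. -/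
theorem exists_critical_price (hw : ∀ j, 0 ≤ w j) (b : Unit ⊕ Fin n → ℕ) (R : Finset (Fin n)) :
    ∃ c : ℝ, (c = 0 ∨ ∃ j, c = w j) ∧ 0 ≤ c ∧
      ∑ j, (if j ∈ R ∧ c < w j then b (Sum.inr j) else 0) ≤ b (Sum.inl ()) ∧
      (c = 0 ∨ b (Sum.inl ()) ≤ ∑ j, if j ∈ R ∧ c ≤ w j then b (Sum.inr j) else 0) := by
  classical
  set C : Finset ℝ := insert 0 (Finset.univ.image w) with hC
  have hCne : C.Nonempty := ⟨0, by simp [hC]⟩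
  have hwC : ∀ j, w j ∈ C := fun j => by simp [hC]
  have hC0 : ∀ c ∈ C, 0 ≤ c := by
    intro c hc
    rcases Finset.mem_insert.1 hc with rfl | hc
    · exact le_rfl
    · obtain ⟨j, -, rfl⟩ := Finset.mem_image.1 hc
      exact hw j
  set A := C.filter fun c =>
    ∑ j, (if j ∈ R ∧ c < w j then b (Sum.inr j) else 0) ≤ b (Sum.inl ()) with hA
  have hAne : A.Nonempty := by
    refine ⟨C.max' hCne, Finset.mem_filter.2 ⟨C.max'_mem hCne, ?_⟩⟩
    rw [Finset.sum_eq_zero fun j _ => if_neg fun h => (C.le_max' _ (hwC j)).not_gt h.2]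
    exact Nat.zero_le _
  obtain ⟨hcC, hcA⟩ := Finset.mem_filter.1 (A.min'_mem hAne)
  set c := A.min' hAne
  refine ⟨c, by simpa [hC, eq_comm] using hcC, hC0 c hcC, hcA, or_iff_not_imp_left.2 fun h0 => ?_⟩
  -- The next smaller candidate violates the capacity of the centre.
  have hne : (C.filter (· < c)).Nonempty :=
    ⟨0, Finset.mem_filter.2 ⟨by simp [hC], lt_of_le_of_ne (hC0 c hcC) (Ne.symm h0)⟩⟩
  set c' := (C.filter (· < c)).max' hne
  obtain ⟨hc'C, hc'c⟩ := Finset.mem_filter.1 ((C.filter (· < c)).max'_mem hne)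
  have hc'A : c' ∉ A := fun h => (A.min'_le _ h).not_gt hc'c
  have hlt := not_le.1 fun h => hc'A (Finset.mem_filter.2 ⟨hc'C, h⟩)
  refine hlt.le.trans (Finset.sum_le_sum fun j _ => ?_)
  by_cases hj : j ∈ R ∧ c' < w j
  · have : c ≤ w j := by
      by_contra! h
      exact ((C.filter (· < c)).le_max' _ (Finset.mem_filter.2 ⟨hwC j, h⟩)).not_gt hj.2
    rw [if_pos hj, if_pos ⟨hj.1, this⟩]
  · rw [if_neg hj]
    exact Nat.zero_le _

/-- Strong duality: the dual optimum is attained at price zero or at the weight of some leaf. -/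
theorem exists_leafWorth_eq_dualValue (hw : ∀ j, 0 ≤ w j) (b : Unit ⊕ Fin n → ℕ)
    (R : Finset (Fin n)) :
    ∃ c : ℝ, (c = 0 ∨ ∃ j, c = w j) ∧ 0 ≤ c ∧ leafWorth w b R = dualValue w b R c := by
  obtain ⟨c, hcand, hc0, hlo, hhi⟩ := exists_critical_price hw b R
  refine ⟨c, hcand, hc0, le_antisymm (leafWorth_le_dualValue w b R hc0) ?_⟩
  set lo : Fin n → ℕ := fun j => if j ∈ R ∧ c < w j then b (Sum.inr j) else 0
  set hi : Fin n → ℕ := fun j => if j ∈ R ∧ c ≤ w j then b (Sum.inr j) else 0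
  have hle : lo ≤ hi := fun j => by
    by_cases hj : j ∈ R ∧ c < w j
    · simp [lo, hi, hj, hj.2.le]
    · simp [lo, hj]
  obtain ⟨x, hx, hx', hT⟩ := exists_sum_eq_of_le_of_le hle
    (T := min (b (Sum.inl ())) (∑ j, hi j)) (le_min hlo (Finset.sum_le_sum fun j _ => hle j))
    (min_le_right _ _)
  have hmatch : (starGraph n w b).IsBMatching (Finset.univ.disjSum R) fun e => x e.2 := by
    refine ⟨fun e he => ⟨by simp [starGraph], by simp, ?_⟩, fun _ => ?_, fun j => ?_⟩
    · by_contra h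
      have := hx' e.2
      simp only [Finset.inr_mem_disjSum] at h
      simp only [hi, h, false_and, if_false] at this
      exact he (Nat.le_zero.1 this)
    · change ∑ j, x j ≤ b (Sum.inl ())
      omega
    · refine (by simpa using hx' j : _ ≤ hi j).trans ?_
      simp only [hi, starGraph]
      split_ifs <;> simp
  refine le_trans (le_of_eq ?_)
    (((starGraph n w b).isGreatest_worth (Finset.univ.disjSum R)).2 ⟨_, hmatch, rfl⟩)
  have hcT : c * (b (Sum.inl ()) : ℝ) = c * ∑ j, (x j : ℝ) := by
    rcases hhi with rfl | h
    · simp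
    · rw [min_eq_left h] at hT
      rw [← hT]
      push_cast
      rfl
  have hsum : ∑ j ∈ R, (b (Sum.inr j) : ℝ) * max (w j - c) 0 = ∑ j, (x j : ℝ) * (w j - c) := by
    rw [← Finset.sum_subset (Finset.subset_univ R)]
    · refine Finset.sum_congr rfl fun j hj => ?_
      have h1 := hx j
      have h2 := hx' j
      rcases lt_trichotomy c (w j) with h | h | h
      · simp only [lo, hi, hj, h, h.le, and_self, if_true] at h1 h2
        rw [le_antisymm h2 h1, max_eq_left (sub_nonneg.2 h.le)]
      · simp [h]
      · simp only [hi, hj, h.not_ge, and_false, if_false, Nat.le_zero] at h2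
        simp [h2, h.le]
    · intro j _ hj
      have h2 := hx' j
      simp only [hi, hj, false_and, if_false, Nat.le_zero] at h2
      simp [h2]
  rw [totalWeight_eq, dualValue, hcT, hsum, Finset.mul_sum, ← Finset.sum_add_distrib]
  exact Finset.sum_congr rfl fun j _ => by ring

/-! ### Leaves are substitutes, and the description of the core -/

/-- The leaves are substitutes: the contribution of a leaf does not increase with the coalition.
Let `c` and `d` be optimal prices for `insert i R` and `R'`. Bound the worth of `insert i R'` by
the dual value at `max c d`, and that of `R` by the dual value at `min c d`. -/
theorem leafWorth_submodular (hw : ∀ j, 0 ≤ w j) {R R' : Finset (Fin n)} (hR : R ⊆ R') {i : Fin n}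
    (hi : i ∉ R') :
    leafWorth w b (insert i R') + leafWorth w b R ≤
      leafWorth w b (insert i R) + leafWorth w b R' := by
  have anti : ∀ {c d : ℝ} (j : Fin n), c ≤ d →
      (b (Sum.inr j) : ℝ) * max (w j - d) 0 ≤ b (Sum.inr j) * max (w j - c) 0 := fun j h => by
    gcongr
  obtain ⟨c, -, hc, hcv⟩ := exists_leafWorth_eq_dualValue hw b (insert i R)
  obtain ⟨d, -, hd, hdv⟩ := exists_leafWorth_eq_dualValue hw b R'
  rw [hcv, hdv]
  have hiR : i ∉ R := fun h => hi (hR h)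
  rcases le_or_gt c d with h | h
  · have h1 := leafWorth_le_dualValue w b (insert i R') hd
    have h2 := leafWorth_le_dualValue w b R hc
    have h3 := anti i h
    simp only [dualValue, Finset.sum_insert hi, Finset.sum_insert hiR] at *
    linarith
  · have h1 := leafWorth_le_dualValue w b (insert i R') hc
    have h2 := leafWorth_le_dualValue w b R hd
    have h3 : ∑ j ∈ R' \ R, (b (Sum.inr j) : ℝ) * max (w j - c) 0 ≤
        ∑ j ∈ R' \ R, b (Sum.inr j) * max (w j - d) 0 :=
      Finset.sum_le_sum fun j _ => anti j h.le
    simp only [dualValue, Finset.sum_insert hi, Finset.sum_insert hiR,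
      ← Finset.sum_sdiff hR] at *
    linarith

theorem sum_marginal_le (hw : ∀ j, 0 ≤ w j) (T : Finset (Fin n)) :
    ∑ i ∈ T, (leafWorth w b Finset.univ - leafWorth w b (Finset.univ.erase i)) ≤
      leafWorth w b Finset.univ - leafWorth w b (Finset.univ \ T) := by
  classical
  induction T using Finset.induction_on with
  | empty => simp
  | insert i T hi ih =>
    have h := leafWorth_submodular (b := b) hw (R := Finset.univ \ insert i T)
      (R' := Finset.univ.erase i) (i := i) (fun j hj => by simp_all) (by simp)
    have h1 : insert i (Finset.univ.erase i) = Finset.univ := Finset.insert_erase (by simp)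
    have h2 : insert i (Finset.univ \ insert i T) = Finset.univ \ T := by
      ext j
      by_cases hj : j = i
      · subst hj; simpa using hi
      · simp [hj]
    rw [h1, h2] at h
    rw [Finset.sum_insert hi]
    linarith

theorem worth_univ_eq : (starGraph n w b).worth Finset.univ = leafWorth w b Finset.univ := by
  rw [leafWorth, Finset.univ_disjSum_univ]

theorem worth_erase_eq (i : Fin n) :
    (starGraph n w b).worth (Finset.univ.erase (Sum.inr i)) =
      leafWorth w b (Finset.univ.erase i) := by
  rw [leafWorth]
  congr 1
  ext (a | a) <;> simp

theorem worth_eq_zero_of_center_notMem {S : Finset (Unit ⊕ Fin n)} (hS : Sum.inl () ∉ S) :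
    (starGraph n w b).worth S = 0 := by
  obtain ⟨x, ⟨hx, -⟩, hxS⟩ := ((starGraph n w b).isGreatest_worth S).1
  rw [← hxS, totalWeight_eq]
  refine Finset.sum_eq_zero fun j _ => ?_
  have : x ((), j) = 0 := by
    by_contra h
    exact hS (hx _ h).2.1
  simp [this]

theorem mem_gameCore_iff (hw : ∀ j, 0 ≤ w j) {p : Unit ⊕ Fin n → ℝ}
    (hp : IsImputation (starGraph n w b).worth p) :
    p ∈ gameCore (starGraph n w b).worth ↔
      ∀ i : Fin n, p (Sum.inr i) ≤ marginalUtility (starGraph n w b).worth (Sum.inr i) := by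
  constructor
  · intro h i
    have h1 := h.2 (Finset.univ.erase (Sum.inr i))
    have h2 := Finset.sum_erase_add Finset.univ p (Finset.mem_univ (Sum.inr i))
    rw [hp.2] at h2
    rw [marginalUtility]
    linarith
  · intro h
    refine ⟨hp, fun S => ?_⟩
    by_cases hS : Sum.inl () ∈ S
    · have hSR : S = Finset.univ.disjSum S.toRight := by
        ext (a | a) <;> simp [hS]
      have hsum : ∑ a ∈ S, p a + ∑ i ∈ Finset.univ \ S.toRight, p (Sum.inr i) =
          leafWorth w b Finset.univ := by
        rw [← worth_univ_eq, ← hp.2, Fintype.sum_sum_type, hSR, Finset.sum_disjSum, add_assoc]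
        congr 1
        rw [Finset.toRight_disjSum, add_comm]
        exact Finset.sum_sdiff (Finset.subset_univ _)
      have hm := sum_marginal_le (b := b) hw (Finset.univ \ S.toRight)
      have hle : ∑ i ∈ Finset.univ \ S.toRight, p (Sum.inr i) ≤ ∑ i ∈ Finset.univ \ S.toRight,
          (leafWorth w b Finset.univ - leafWorth w b (Finset.univ.erase i)) :=
        Finset.sum_le_sum fun i _ => by
          simpa only [marginalUtility, worth_univ_eq, worth_erase_eq] using h i
      rw [sdiff_sdiff_right_self, Finset.inf_eq_inter, Finset.univ_inter] at hm
      rw [hSR, ← leafWorth, ← hSR]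
      linarith
    · rw [worth_eq_zero_of_center_notMem hS]
      exact Finset.sum_nonneg fun a _ => hp.1 a

end StarGame

/-! ### Program logic for the random access machine -/

namespace RAM

section Logic

variable {K : Type*} [CommRing K] [LinearOrder K]

/-- The next step of `c` is tame: constants are at most `7`, and the first factor of a product is
a natural number at most `B`. Tame steps increase the binary lengths of the data only by an
amount bounded in terms of `B`. -/
def TameStep (B : ℕ) (c : Config K) : Prop :=
  match c.todo with
  | .idxConst _ a :: _ => a ≤ 7
  | .dataConst _ a :: _ => a ≤ 7
  | .dataMul _ j _ :: _ => ∃ m : ℕ, m ≤ B ∧ c.store.get j = m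
  | _ => True

/-- Total correctness with a time bound: started on `s`, the program `P` is finished after at most
`c` steps, all of them tame, in a store that satisfies `Q`. The rest `r` of the stack is
arbitrary. -/
def Terminates (B c : ℕ) (P : Prog) (s : Store K) (Q : Store K → Prop) : Prop :=
  ∃ t ≤ c, ∃ s', Q s' ∧ ∀ r, step^[t] ⟨P :: r, s⟩ = ⟨r, s'⟩ ∧
    ∀ τ < t, TameStep B (step^[τ] ⟨P :: r, s⟩)

namespace Terminates

variable {B c c' : ℕ} {P P' : Prog} {s : Store K} {Q Q' : Store K → Prop}

theorem mono (h : Terminates B c P s Q) (hc : c ≤ c') (hQ : ∀ s', Q s' → Q' s') :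
    Terminates B c' P s Q' := by
  obtain ⟨t, ht, s', hs', hr⟩ := h
  exact ⟨t, ht.trans hc, s', hQ s' hs', hr⟩

/-- A tame step that leaves the statement finished. -/
theorem of_step {s' : Store K} (h : ∀ r, step ⟨P :: r, s⟩ = ⟨r, s'⟩)
    (htame : ∀ r, TameStep B ⟨P :: r, s⟩) (hQ : Q s') : Terminates B 1 P s Q := by
  refine ⟨1, le_rfl, s', hQ, fun r => ⟨h r, fun τ hτ => ?_⟩⟩
  obtain rfl : τ = 0 := by omega
  exact htame r

/-- A tame step that replaces `P` by `P'`. -/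
theorem of_step_to (h : ∀ r, step ⟨P :: r, s⟩ = ⟨P' :: r, s⟩)
    (htame : ∀ r, TameStep B ⟨P :: r, s⟩) (hP : Terminates B c P' s Q) :
    Terminates B (c + 1) P s Q := by
  obtain ⟨t, ht, s', hs', hr⟩ := hP
  refine ⟨t + 1, by omega, s', hs', fun r => ⟨?_, fun τ hτ => ?_⟩⟩
  · rw [Function.iterate_succ_apply, h, (hr r).1]
  · cases τ with
    | zero => exact htame r
    | succ τ =>
      rw [Function.iterate_succ_apply, h]
      exact (hr r).2 τ (by omega)

/-- A tame step that replaces `P` by `P'` followed by `P''`. -/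
theorem of_step_seq {P'' : Prog} (h : ∀ r, step ⟨P :: r, s⟩ = ⟨P' :: P'' :: r, s⟩)
    (htame : ∀ r, TameStep B ⟨P :: r, s⟩)
    (hP : Terminates B c P' s fun s' => Terminates B c' P'' s' Q) :
    Terminates B (c + c' + 1) P s Q := by
  obtain ⟨t, ht, s', ⟨t', ht', s'', hs'', hr'⟩, hr⟩ := hP
  refine ⟨t' + t + 1, by omega, s'', hs'', fun r => ⟨?_, fun τ hτ => ?_⟩⟩
  · rw [Function.iterate_succ_apply, h, Function.iterate_add_apply, (hr _).1, (hr' r).1]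
  · cases τ with
    | zero => exact htame r
    | succ τ =>
      rw [Function.iterate_succ_apply, h]
      rcases lt_or_ge τ t with hlt | hge
      · exact (hr _).2 τ hlt
      · obtain ⟨σ, rfl⟩ := Nat.exists_eq_add_of_le' hge
        rw [Function.iterate_add_apply, (hr _).1]
        exact (hr' r).2 σ (by omega)

theorem skip (hQ : Q s) : Terminates B 1 .skip s Q :=
  of_step (fun _ => rfl) (fun _ => trivial) hQ

theorem seq (h : Terminates B c P s fun s' => Terminates B c' P' s' Q) :
    Terminates B (c + c' + 1) (.seq P P') s Q :=
  of_step_seq (fun _ => rfl) (fun _ => trivial) h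

theorem ite {t : Test} (h : t.eval s = true → Terminates B c P s Q)
    (h' : t.eval s = false → Terminates B c P' s Q) : Terminates B (c + 1) (.ite t P P') s Q := by
  cases ht : t.eval s with
  | true => exact of_step_to (fun r => by simp [step, ht]) (fun _ => trivial) (h ht)
  | false => exact of_step_to (fun r => by simp [step, ht]) (fun _ => trivial) (h' ht)

theorem idxConst {i a : ℕ} (ha : a ≤ 7) (hQ : Q (s.setIdx i a)) :
    Terminates B 1 (.idxConst i a) s Q :=
  of_step (fun _ => rfl) (fun _ => ha) hQ

theorem idxAdd {i j k : ℕ} (hQ : Q (s.setIdx i (s.idx j + s.idx k))) :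
    Terminates B 1 (.idxAdd i j k) s Q :=
  of_step (fun _ => rfl) (fun _ => trivial) hQ

theorem idxSub {i j k : ℕ} (hQ : Q (s.setIdx i (s.idx j - s.idx k))) :
    Terminates B 1 (.idxSub i j k) s Q :=
  of_step (fun _ => rfl) (fun _ => trivial) hQ

theorem dataConst {i a : ℕ} (ha : a ≤ 7) (hQ : Q (s.setMem i (a : K))) :
    Terminates B 1 (.dataConst i a) s Q :=
  of_step (fun _ => rfl) (fun _ => ha) hQ

theorem dataAdd {i j k : ℕ} (hQ : Q (s.setMem i (s.get j + s.get k))) :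
    Terminates B 1 (.dataAdd i j k) s Q :=
  of_step (fun _ => rfl) (fun _ => trivial) hQ

theorem dataSub {i j k : ℕ} (hQ : Q (s.setMem i (s.get j - s.get k))) :
    Terminates B 1 (.dataSub i j k) s Q :=
  of_step (fun _ => rfl) (fun _ => trivial) hQ

theorem dataMul {i j k : ℕ} (hj : ∃ m : ℕ, m ≤ B ∧ s.get j = m)
    (hQ : Q (s.setMem i (s.get j * s.get k))) : Terminates B 1 (.dataMul i j k) s Q :=
  of_step (fun _ => rfl) (fun _ => hj) hQ

/-- A loop with invariant `Inv k` after `k` of its `N` rounds. -/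
theorem loop {t : Test} {N : ℕ} {Inv : ℕ → Store K → Prop}
    (hbody : ∀ k < N, ∀ s, Inv k s → t.eval s = true ∧ Terminates B c P s (Inv (k + 1)))
    (hexit : ∀ s, Inv N s → t.eval s = false) (h0 : Inv 0 s) :
    Terminates B (N * (c + 1) + 1) (.loop t P) s (Inv N) := by
  suffices H : ∀ d k s, k + d = N → Inv k s →
      Terminates B (d * (c + 1) + 1) (.loop t P) s (Inv N) from H N 0 s (by omega) h0
  intro d
  induction d with
  | zero =>
    intro k s hk hs
    obtain rfl : k = N := hk
    rw [zero_mul, zero_add]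
    exact of_step (fun r => by simp [step, hexit s hs]) (fun _ => trivial) hs
  | succ d ih =>
    intro k s hk hs
    obtain ⟨ht, hP⟩ := hbody k (by omega) s hs
    refine (of_step_seq (P := .loop t P) (P'' := .loop t P) (s := s)
      (fun r => by simp [step, ht]) (fun _ => trivial)
      (hP.mono le_rfl fun s' hs' => ih (k + 1) s' (by omega) hs')).mono (le_of_eq (by ring))
      fun _ h => h

end Terminates

end Logic

end RAM

/-! ### The program -/

namespace RAM

open Prog

/-- `acc := acc + b_j * (w_j - w_l)`. -/
def addTermProg : Prog :=
  seq (dataSub 6 10 9) (seq (idxAdd 11 10 1) (seq (dataMul 6 11 6) (dataAdd 5 5 6)))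

/-- Adds the terms of all leaves `j ≠ i` with `w_l < w_j` to `acc`. -/
def dualLoop : Prog :=
  loop (.idxLe 10 4)
    (seq (ite (.dataLt 9 10)
        (ite (.idxLt 10 8) addTermProg (ite (.idxLt 8 10) addTermProg skip)) skip)
      (idxAdd 10 10 2))

/-- Minimizes the dual value without leaf `i` over the prices `w_l`. The test `I[9] < I[2]`
recognizes the first round. -/
def minLoop : Prog :=
  loop (.idxLe 9 4)
    (seq (dataMul 5 3 9) (seq (idxConst 10 2) (seq dualLoop
      (seq (ite (.idxLt 9 2) (dataAdd 7 5 4) (ite (.dataLt 5 7) (dataAdd 7 5 4) skip))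
        (idxAdd 9 9 2)))))

/-- Computes the worth without leaf `i` for all `i ≤ n`. -/
def worthLoop : Prog :=
  loop (.idxLe 8 4) (seq (idxConst 9 2) (seq minLoop (seq (idxAdd 8 8 2) (idxAdd 7 7 1))))

/-- Tests `p_i ≤ ν(G) - ν(G ∖ v_i)` and moves `ν(G ∖ v_i)` to its place, for all `i < n`. -/
def outputLoop : Prog :=
  loop (.idxLt 8 4)
    (seq (idxAdd 11 8 1) (seq (idxAdd 11 11 1) (seq (dataSub 6 1 7)
      (seq (ite (.dataLt 6 11) (dataConst 3 0) skip) (seq (dataAdd 12 7 4)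
        (seq (idxAdd 8 8 2) (seq (idxAdd 7 7 1) (idxAdd 12 12 1))))))))

/-- Sets the index registers. -/
def setupProg : Prog :=
  seq (idxConst 1 1) (seq (idxConst 2 3) (seq (idxAdd 4 0 0) (seq (idxAdd 4 4 0)
    (seq (idxConst 5 5) (seq (idxAdd 5 4 5) (seq (idxConst 6 6) (seq (idxAdd 6 4 6)
      (seq (idxConst 7 7) (seq (idxAdd 7 4 7) (seq (idxConst 8 2) (idxAdd 4 4 8)))))))))))

/-- Initializes the output phase: `M[1] := ν(G)`, `M[0] := 1`. -/
def outputSetupProg : Prog :=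
  seq (idxSub 7 7 1) (seq (dataAdd 1 7 4) (seq (dataConst 3 1) (seq (idxConst 8 2)
    (seq (idxAdd 7 6 1) (idxConst 12 2)))))

/-- The program that decides membership in the core of a star game. The cells `2 + 3n`, `3 + 3n`,
`4 + 3n` behind the input are zero and serve as an additional leaf `n` of weight and capacity zero:
its weight is the dual price zero, and the game without it is the whole game.

Cell `5 + 3n` is the accumulator `acc`, cell `6 + 3n` is auxiliary, and cell `7 + 3n + i` receives
the worth without leaf `i`. The registers `I[1] = 1`, `I[2] = 3`, `I[3] = 0`, `I[4] = 2 + 3n`,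
`I[5] = 5 + 3n` and `I[6] = 6 + 3n` are constant; `I[8]`, `I[9]`, `I[10]` are the addresses of the
weights of the leaves `i`, `l`, `j`, and `I[7] = 7 + 3n + i`. -/
def starProg : Prog :=
  seq setupProg (seq worthLoop (seq outputSetupProg outputLoop))

section Correctness

variable {K : Type*}

/-- The store in round `i` of the loop over the excluded leaf, with input cells `m` and result
cells `out`. -/
structure Frame (n i : ℕ) (m out : ℕ → K) (s : Store K) : Prop where
  idx1 : s.idx 1 = 1
  idx2 : s.idx 2 = 3
  idx3 : s.idx 3 = 0
  idx4 : s.idx 4 = 2 + 3 * n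
  idx5 : s.idx 5 = 5 + 3 * n
  idx6 : s.idx 6 = 6 + 3 * n
  idx7 : s.idx 7 = 7 + 3 * n + i
  idx8 : s.idx 8 = 2 + 3 * i
  input : ∀ a < 5 + 3 * n, s.mem a = m a
  output : ∀ a, s.mem (7 + 3 * n + a) = out a

namespace Frame

variable {n i : ℕ} {m out : ℕ → K} {s : Store K}

theorem setIdx (h : Frame n i m out s) {r a : ℕ} (hr : 9 ≤ r) : Frame n i m out (s.setIdx r a) := by
  obtain ⟨h1, h2, h3, h4, h5, h6, h7, h8, hin, hout⟩ := h
  constructor <;> simp only [Store.setIdx] <;> first | assumption | skip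
  all_goals rw [Function.update_of_ne (by omega)]; assumption

theorem setMem (h : Frame n i m out s) {r : ℕ} {x : K} (hr : r = 5 ∨ r = 6) :
    Frame n i m out (s.setMem r x) := by
  have hr' : s.idx r = 5 + 3 * n ∨ s.idx r = 6 + 3 * n := by
    rcases hr with rfl | rfl
    · exact .inl h.idx5
    · exact .inr h.idx6
  obtain ⟨h1, h2, h3, h4, h5, h6, h7, h8, hin, hout⟩ := h
  constructor <;> simp only [Store.setMem] <;> first | assumption | skip
  · intro a ha
    rw [Function.update_of_ne (by omega), hin a ha]
  · intro a
    rw [Function.update_of_ne (by omega), hout a]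

theorem setMem_output (h : Frame n i m out s) (x : K) :
    Frame n i m (Function.update out i x) (s.setMem 7 x) := by
  have h7' := h.idx7
  obtain ⟨h1, h2, h3, h4, h5, h6, h7, h8, hin, hout⟩ := h
  constructor <;> simp only [Store.setMem] <;> first | assumption | skip
  · intro a ha
    rw [Function.update_of_ne (by omega), hin a ha]
  · intro a
    by_cases ha : a = i
    · subst ha; rw [h7', Function.update_self, Function.update_self]
    · rw [Function.update_of_ne (by omega), Function.update_of_ne ha, hout a]

end Frame

variable [CommRing K] [LinearOrder K]

/-- The dual value at price `w_l` of the game without leaf `i`, read off the input cells `m`. -/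
def dualCell (n : ℕ) (m : ℕ → K) (i l : ℕ) : K :=
  m 0 * m (2 + 3 * l) + ∑ j ∈ Finset.range (n + 1),
    if m (2 + 3 * l) < m (2 + 3 * j) ∧ j ≠ i then m (3 + 3 * j) * (m (2 + 3 * j) - m (2 + 3 * l))
    else 0

/-- `v` is the least dual value of the game without leaf `i` at a price `w_l`, `l ≤ n`. -/
def IsLeastDual (n : ℕ) (m : ℕ → K) (i : ℕ) (v : K) : Prop :=
  (∀ l ≤ n, v ≤ dualCell n m i l) ∧ ∃ l ≤ n, v = dualCell n m i l

/-- The input cells that the program uses as first factors of products, the capacities, hold natural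
numbers at most `B`, and the cell behind the input is zero. -/
structure TameInput (n B : ℕ) (m : ℕ → K) : Prop where
  zero : m (2 + 3 * n) = 0
  center : ∃ c : ℕ, c ≤ B ∧ m 0 = c
  leaf : ∀ j ≤ n, ∃ c : ℕ, c ≤ B ∧ m (3 + 3 * j) = c

variable {n B i l : ℕ} {m out : ℕ → K}

theorem terminates_addTermProg (hm : TameInput n B m) {j : ℕ} (hj : j ≤ n) (hl : l ≤ n) {x : K}
    {s : Store K} (h : Frame n i m out s) (h9 : s.idx 9 = 2 + 3 * l) (h10 : s.idx 10 = 2 + 3 * j)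
    (hx : s.mem (5 + 3 * n) = x) :
    Terminates B 7 addTermProg s fun s' => Frame n i m out s' ∧ s'.idx 9 = 2 + 3 * l ∧
      s'.idx 10 = 2 + 3 * j ∧
      s'.mem (5 + 3 * n) = x + m (3 + 3 * j) * (m (2 + 3 * j) - m (2 + 3 * l)) := by
  have hj3 : 2 + 3 * j + 1 = 3 + 3 * j := by omega
  have h1 := h.idx1
  have h5 := h.idx5
  have h6 := h.idx6
  have hwj := h.input (2 + 3 * j) (by omega)
  have hwl := h.input (2 + 3 * l) (by omega)
  have hbj := h.input (3 + 3 * j) (by omega)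
  have hne : 3 + 3 * j ≠ 6 + 3 * n := by omega
  refine .seq (.dataSub (.seq (.idxAdd (.seq (.dataMul ?_ (.dataAdd ?_))))))
  · obtain ⟨c, hc, hc'⟩ := hm.leaf j hj
    refine ⟨c, hc, ?_⟩
    simp [Store.get, Store.setIdx, Store.setMem, h10, h1, h6, hj3, hne, hbj,
      hc']
  · refine ⟨(((h.setMem (.inr rfl)).setIdx (by norm_num)).setMem (.inr rfl)).setMem (.inl rfl),
      ?_, ?_, ?_⟩
    · simpa [Store.setIdx, Store.setMem] using h9
    · simpa [Store.setIdx, Store.setMem] using h10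
    · simp [Store.get, Store.setIdx, Store.setMem, h10, h1, h6, h5, hj3, hne,
        hbj, h9, hwj, hwl, hx]

theorem terminates_dualLoop (hm : TameInput n B m) (hl : l ≤ n) {x : K}
    {s : Store K} (h : Frame n i m out s) (h9 : s.idx 9 = 2 + 3 * l) (h10 : s.idx 10 = 2)
    (hx : s.mem (5 + 3 * n) = x) :
    Terminates B ((n + 1) * 13 + 1) dualLoop s fun s' => Frame n i m out s' ∧
      s'.idx 9 = 2 + 3 * l ∧
      s'.mem (5 + 3 * n) = x + ∑ j ∈ Finset.range (n + 1),
        if m (2 + 3 * l) < m (2 + 3 * j) ∧ j ≠ i then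
          m (3 + 3 * j) * (m (2 + 3 * j) - m (2 + 3 * l)) else 0 := by
  refine (Terminates.loop (N := n + 1) (c := 12) (Inv := fun k s' => Frame n i m out s' ∧
    s'.idx 9 = 2 + 3 * l ∧ s'.idx 10 = 2 + 3 * k ∧
      s'.mem (5 + 3 * n) = x + ∑ j ∈ Finset.range k,
        if m (2 + 3 * l) < m (2 + 3 * j) ∧ j ≠ i then
          m (3 + 3 * j) * (m (2 + 3 * j) - m (2 + 3 * l)) else 0)
    ?_ ?_ ⟨h, h9, h10, by simpa using hx⟩).mono le_rfl
    fun s' hs' => ⟨hs'.1, hs'.2.1, hs'.2.2.2⟩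
  · rintro j hj s ⟨hF, h9, h10, hx⟩
    have hj' : j ≤ n := by omega
    refine ⟨by simp [Test.eval, h10, hF.idx4, hj'], ?_⟩
    have hadd := terminates_addTermProg hm hj' hl hF h9 h10 hx
    set y := ∑ j ∈ Finset.range j, if m (2 + 3 * l) < m (2 + 3 * j) ∧ j ≠ i then
          m (3 + 3 * j) * (m (2 + 3 * j) - m (2 + 3 * l)) else 0
    have hwj := hF.input (2 + 3 * j) (by omega)
    have hwl := hF.input (2 + 3 * l) (by omega)
    have h8 := hF.idx8
    have step : Terminates B 10 (ite (.dataLt 9 10)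
        (ite (.idxLt 10 8) addTermProg (ite (.idxLt 8 10) addTermProg skip)) skip) s fun s' =>
        Frame n i m out s' ∧ s'.idx 9 = 2 + 3 * l ∧ s'.idx 10 = 2 + 3 * j ∧
        s'.mem (5 + 3 * n) = x + y + if m (2 + 3 * l) < m (2 + 3 * j) ∧ j ≠ i then
          m (3 + 3 * j) * (m (2 + 3 * j) - m (2 + 3 * l)) else 0 := by
      refine .ite (c := 9) (fun hlt => .ite (c := 8) (fun hji => ?_) (fun hji => .ite (c := 7)
        (fun hij => ?_) fun hij => ?_)) fun hlt => ?_ <;>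
        simp only [Test.eval, Store.get, h9, h10, hwj, hwl, decide_eq_true_eq,
          decide_eq_false_iff_not] at hlt
      · simp only [Test.eval, h10, h8, decide_eq_true_eq] at hji
        rw [if_pos ⟨hlt, by omega⟩]
        exact hadd.mono (by norm_num) fun _ h => h
      · simp only [Test.eval, h10, h8, decide_eq_true_eq] at hij
        rw [if_pos ⟨hlt, by omega⟩]
        exact hadd
      · simp only [Test.eval, h10, h8, decide_eq_false_iff_not] at hij hji
        rw [if_neg (by omega), add_zero]
        exact (Terminates.skip ⟨hF, h9, h10, hx⟩).mono (by norm_num) fun _ h => h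
      · rw [if_neg (by tauto), add_zero]
        exact (Terminates.skip ⟨hF, h9, h10, hx⟩).mono (by norm_num) fun _ h => h
    refine .seq (c := 10) (c' := 1) (step.mono le_rfl ?_)
    rintro s' ⟨hF, h9, h10, hx⟩
    refine .idxAdd ⟨hF.setIdx (by norm_num), ?_, ?_, ?_⟩
    · simpa [Store.setIdx] using h9
    · simp [Store.setIdx, h10, hF.idx2]
      omega
    · rw [Finset.sum_range_succ, ← add_assoc]
      simpa [Store.setIdx] using hx
  · rintro s ⟨hF, -, h10, -⟩
    simp [Test.eval, h10, hF.idx4]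

theorem terminates_minLoop (hm : TameInput n B m) {s : Store K} (h : Frame n i m out s)
    (h9 : s.idx 9 = 2) :
    Terminates B ((n + 1) * ((n + 1) * 13 + 12) + 1) minLoop s fun s' =>
      ∃ v, Frame n i m (Function.update out i v) s' ∧ IsLeastDual n m i v := by
  refine (Terminates.loop (N := n + 1) (c := (n + 1) * 13 + 11) (Inv := fun k s' =>
    ∃ v, Frame n i m (Function.update out i v) s' ∧ s'.idx 9 = 2 + 3 * k ∧
      (∀ l < k, v ≤ dualCell n m i l) ∧ (0 < k → ∃ l < k, v = dualCell n m i l))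
    ?_ ?_ ⟨out i, by simpa using h, h9, by simp, by simp⟩).mono le_rfl ?_
  · rintro l hl s ⟨v, hF, h9, hle, hmem⟩
    have hl' : l ≤ n := by omega
    refine ⟨by simp [Test.eval, h9, hF.idx4, hl'], ?_⟩
    have hwl := hF.input (2 + 3 * l) (by omega)
    have hb := hF.input 0 (by omega)
    have hdual : Terminates B ((n + 1) * 13 + 1) dualLoop
        ((s.setMem 5 (s.get 3 * s.get 9)).setIdx 10 2) fun s' =>
        Frame n i m (Function.update out i v) s' ∧ s'.idx 9 = 2 + 3 * l ∧
          s'.mem (5 + 3 * n) = dualCell n m i l := by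
      refine terminates_dualLoop hm hl' ((hF.setMem (.inl rfl)).setIdx (by norm_num)) ?_ ?_ ?_
      · simpa [Store.setIdx, Store.setMem] using h9
      · simp [Store.setIdx]
      · simp [Store.setIdx, Store.setMem, Store.get, hF.idx3, h9, hF.idx5, hb, hwl]
    refine (Terminates.seq (c := 1) (.dataMul ?_ (.seq (c := 1) (.idxConst (by norm_num)
      (.seq (hdual.mono le_rfl ?_ (Q' := fun s' => Terminates B 5 _ s' _))))))).mono (by omega)
      fun _ h => h
    · obtain ⟨c, hc, hc'⟩ := hm.center
      exact ⟨c, hc, by simp [Store.get, hF.idx3, hb, hc']⟩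
    rintro s ⟨hF, h9, hx⟩
    have hzero : s.mem (2 + 3 * n) = 0 := by rw [hF.input _ (by omega), hm.zero]
    have hv : s.get 7 = v := by rw [Store.get, hF.idx7, hF.output, Function.update_self]
    have hx' : s.get 5 = dualCell n m i l := by rw [Store.get, hF.idx5, hx]
    have hz' : s.get 4 = 0 := by rw [Store.get, hF.idx4, hzero]
    have hcopy : Frame n i m (Function.update out i (dualCell n m i l))
        (s.setMem 7 (s.get 5 + s.get 4)) ∧
        (s.setMem 7 (s.get 5 + s.get 4)).idx 9 = 2 + 3 * l := by
      have := hF.setMem_output (s.get 5 + s.get 4)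
      rw [Function.update_idem, hx', hz', add_zero] at this
      rw [hx', hz', add_zero]
      exact ⟨this, h9⟩
    have hmin : Terminates B 3 (ite (.idxLt 9 2) (dataAdd 7 5 4)
        (ite (.dataLt 5 7) (dataAdd 7 5 4) skip)) s fun s' =>
        ∃ v, (Frame n i m (Function.update out i v) s' ∧ s'.idx 9 = 2 + 3 * l) ∧
          (∀ l' < l + 1, v ≤ dualCell n m i l') ∧ ∃ l' < l + 1, v = dualCell n m i l' := by
      refine .ite (c := 2) (fun h0 => ?_) fun h0 => .ite (c := 1) (fun hlt => ?_) fun hlt => ?_ <;>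
        simp only [Test.eval, h9, hF.idx2, decide_eq_true_eq, decide_eq_false_iff_not] at h0
      · refine .mono (.dataAdd ⟨_, hcopy, fun l' h' => ?_, l, by omega, rfl⟩) (by norm_num)
          fun _ h => h
        obtain rfl : l' = l := by omega
        exact le_rfl
      · simp only [Test.eval, hv, hx', decide_eq_true_eq] at hlt
        refine .dataAdd ⟨_, hcopy, fun l' h' => ?_, l, by omega, rfl⟩
        rcases Nat.lt_succ_iff_lt_or_eq.1 h' with h' | rfl
        · exact hlt.le.trans (hle l' h')
        · exact le_rfl
      · simp only [Test.eval, hv, hx', decide_eq_false_iff_not, not_lt] at hlt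
        obtain ⟨l', h', hv'⟩ := hmem (by omega)
        refine .skip ⟨v, ⟨hF, h9⟩, fun l' h' => ?_, l', by omega, hv'⟩
        rcases Nat.lt_succ_iff_lt_or_eq.1 h' with h' | rfl
        · exact hle l' h'
        · exact hlt
    refine .seq (c := 3) (c' := 1) (hmin.mono le_rfl ?_)
    rintro s ⟨v, ⟨hF, h9⟩, hle, hmem⟩
    refine .idxAdd ⟨v, hF.setIdx (by norm_num), ?_, hle, fun _ => hmem⟩
    simp [Store.setIdx, h9, hF.idx2]
    omega
  · rintro s ⟨v, hF, h9, -⟩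
    simp [Test.eval, h9, hF.idx4]
  · rintro s ⟨v, hF, -, hle, hmem⟩
    obtain ⟨l, hl, hv⟩ := hmem (by omega)
    exact ⟨v, hF, fun l hl => hle l (by omega), l, by omega, hv⟩

theorem terminates_worthLoop (hm : TameInput n B m) {s : Store K} (h : Frame n 0 m out s) :
    Terminates B ((n + 1) * ((n + 1) * ((n + 1) * 13 + 12) + 8) + 1) worthLoop s fun s' =>
      ∃ out, Frame n (n + 1) m out s' ∧ ∀ i ≤ n, IsLeastDual n m i (out i) := by
  refine (Terminates.loop (N := n + 1) (c := (n + 1) * ((n + 1) * 13 + 12) + 7)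
    (Inv := fun k s' => ∃ out, Frame n k m out s' ∧ ∀ i < k, IsLeastDual n m i (out i))
    ?_ ?_ ⟨out, h, by simp⟩).mono le_rfl ?_
  · rintro i hi s ⟨out, hF, hout⟩
    have hi' : i ≤ n := by omega
    refine ⟨by simp [Test.eval, hF.idx4, hF.idx8, hi'], ?_⟩
    refine (Terminates.seq (c := 1) (.idxConst (by norm_num) (.seq
      ((terminates_minLoop hm (hF.setIdx (by norm_num)) (by simp [Store.setIdx])).mono le_rfl ?_
        (Q' := fun s' => Terminates B 3 _ s' _))))).mono (by omega) fun _ h => h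
    rintro s ⟨v, hF, hv⟩
    refine .seq (.idxAdd (.idxAdd ⟨Function.update out i v, ?_, ?_⟩))
    · obtain ⟨h1, h2, h3, h4, h5, h6, h7, h8, hin, hout⟩ := hF
      constructor <;> simp only [Store.setIdx, Function.update_apply] <;> norm_num <;>
        first | assumption | omega | simpa only [Function.update_apply] using hout
    · intro i' hi'
      rcases Nat.lt_succ_iff_lt_or_eq.1 hi' with hi' | rfl
      · rw [Function.update_of_ne hi'.ne]
        exact hout i' hi'
      · rwa [Function.update_self]
  · rintro s ⟨out, hF, -⟩
    simp [Test.eval, hF.idx4, hF.idx8]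
  · rintro s ⟨out, hF, hout⟩
    exact ⟨out, hF, fun i hi => hout i (by omega)⟩

theorem terminates_setupProg {s : Store K} (h0 : s.idx 0 = n) (hidx : ∀ r, r ≠ 0 → s.idx r = 0)
    (hmem : ∀ a, s.mem a = m a) :
    Terminates B 23 setupProg s (Frame n 0 m fun a => m (7 + 3 * n + a)) := by
  refine .seq (c := 1) (c' := 21) (.idxConst (by norm_num) ?_)
  refine .seq (c := 1) (c' := 19) (.idxConst (by norm_num) ?_)
  refine .seq (c := 1) (c' := 17) (.idxAdd ?_)
  refine .seq (c := 1) (c' := 15) (.idxAdd ?_)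
  refine .seq (c := 1) (c' := 13) (.idxConst (by norm_num) ?_)
  refine .seq (c := 1) (c' := 11) (.idxAdd ?_)
  refine .seq (c := 1) (c' := 9) (.idxConst (by norm_num) ?_)
  refine .seq (c := 1) (c' := 7) (.idxAdd ?_)
  refine .seq (c := 1) (c' := 5) (.idxConst (by norm_num) ?_)
  refine .seq (c := 1) (c' := 3) (.idxAdd ?_)
  refine .seq (c := 1) (c' := 1) (.idxConst (by norm_num) ?_)
  refine .idxAdd ?_
  have h3 := hidx 3 (by norm_num)
  constructor <;> simp [Store.setIdx, h0, h3, hmem] <;> omega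

/-- The store in the output phase: the results of the leaves `i < k` have been moved to the cells
`2 + i`, and `M[0]` tells whether the shares of the leaves `i < f` are at most their marginal
utilities. -/
structure OutputFrame (n k f : ℕ) (m out : ℕ → K) (s : Store K) : Prop where
  idx1 : s.idx 1 = 1
  idx2 : s.idx 2 = 3
  idx3 : s.idx 3 = 0
  idx4 : s.idx 4 = 2 + 3 * n
  idx6 : s.idx 6 = 6 + 3 * n
  idx7 : s.idx 7 = 7 + 3 * n + k
  idx8 : s.idx 8 = 2 + 3 * k
  idx12 : s.idx 12 = 2 + k
  flag : (s.mem 0 = 1 ∧ ∀ i < f, m (4 + 3 * i) ≤ out n - out i) ∨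
    (s.mem 0 = 0 ∧ ∃ i < f, out n - out i < m (4 + 3 * i))
  total : s.mem 1 = out n
  moved : ∀ i < k, s.mem (2 + i) = out i
  input : ∀ a, 2 + k ≤ a → a < 5 + 3 * n → s.mem a = m a
  output : ∀ a, s.mem (7 + 3 * n + a) = out a

theorem terminates_outputSetupProg (hm : TameInput n B m) {s : Store K}
    (h : Frame n (n + 1) m out s) :
    Terminates B 11 outputSetupProg s (OutputFrame n 0 0 m out) := by
  obtain ⟨h1, h2, h3, h4, h5, h6, h7, h8, hin, hout⟩ := h
  have hz : s.mem (2 + 3 * n) = 0 := by rw [hin _ (by omega), hm.zero]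
  have hn := hout n
  have h7' : 7 + 3 * n + (n + 1) - 1 = 7 + 3 * n + n := by omega
  refine .seq (c := 1) (c' := 9) (.idxSub ?_)
  refine .seq (c := 1) (c' := 7) (.dataAdd ?_)
  refine .seq (c := 1) (c' := 5) (.dataConst (by norm_num) ?_)
  refine .seq (c := 1) (c' := 3) (.idxConst (by norm_num) ?_)
  refine .seq (c := 1) (c' := 1) (.idxAdd ?_)
  refine .idxConst (by norm_num) ?_
  constructor
  case flag => exact .inl ⟨by simp [Store.setIdx, Store.setMem, h3], by simp⟩
  case input =>
    intro a ha ha'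
    simp only [Store.setIdx, Store.setMem, Store.get, Function.update_apply]
    norm_num [h1, h3]
    rw [if_neg (by omega), if_neg (by omega), hin a ha']
  case output =>
    intro a
    simp only [Store.setIdx, Store.setMem, Store.get, Function.update_apply]
    norm_num [h1, h3]
    rw [if_neg (by omega), hout a]
  all_goals
    simp only [Store.setIdx, Store.setMem, Store.get, Function.update_apply]
    norm_num [h1, h2, h3, h4, h6, h7, h7', hz, hn]
  omega

theorem terminates_outputLoop (hm : TameInput n B m) {s : Store K}
    (h : OutputFrame n 0 0 m out s) :
    Terminates B (n * 17 + 1) outputLoop s (OutputFrame n n n m out) := by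
  refine Terminates.loop (c := 16) (Inv := fun k => OutputFrame n k k m out) ?_ ?_ h
  · intro k hk s h
    refine ⟨by simp [Test.eval, h.idx4, h.idx8, hk], ?_⟩
    obtain ⟨h1, h2, h3, h4, h6, h7, h8, h12, hflag, htot, hmov, hin, hout⟩ := h
    set s₁ := ((s.setIdx 11 (s.idx 8 + s.idx 1)).setIdx 11
      ((s.setIdx 11 (s.idx 8 + s.idx 1)).idx 11 + (s.setIdx 11 (s.idx 8 + s.idx 1)).idx 1)) with hs₁
    have h11 : s₁.idx 11 = 4 + 3 * k := by
      simp [hs₁, Store.setIdx, h1, h8]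
      omega
    have htest : Terminates B 2 (ite (.dataLt 6 11) (dataConst 3 0) skip)
        (s₁.setMem 6 (s₁.get 1 - s₁.get 7)) (OutputFrame n k (k + 1) m out) := by
      have hl : (s₁.setMem 6 (s₁.get 1 - s₁.get 7)).get 6 = out n - out k := by
        simp [hs₁, Store.setIdx, Store.setMem, Store.get, h1, h7, htot, hout]
      have hr : (s₁.setMem 6 (s₁.get 1 - s₁.get 7)).get 11 = m (4 + 3 * k) := by
        have : 4 + 3 * k ≠ s₁.idx 6 := by simp [hs₁, Store.setIdx, h6]; omega
        simp only [Store.setMem, Store.get, h11]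
        rw [Function.update_of_ne this]
        exact hin _ (by omega) (by omega)
      refine .ite (c := 1) (fun hlt => .dataConst (by norm_num) ?_) fun hlt => .skip ?_ <;>
        simp only [Test.eval, hl, hr, decide_eq_true_eq, decide_eq_false_iff_not, not_lt] at hlt
      · constructor
        case flag =>
          exact .inr ⟨by simp [hs₁, Store.setIdx, Store.setMem, h3], k, by omega, hlt⟩
        case moved =>
          intro i hi
          simp only [hs₁, Store.setIdx, Store.setMem, Store.get, Function.update_apply]
          norm_num [h3, h6]
          rw [if_neg (by omega), hmov i hi]
        case input =>
          intro a ha ha'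
          simp only [hs₁, Store.setIdx, Store.setMem, Store.get, Function.update_apply]
          norm_num [h3, h6]
          rw [if_neg (by omega), if_neg (by omega), hin a ha ha']
        case output =>
          intro a
          simp only [hs₁, Store.setIdx, Store.setMem, Store.get, Function.update_apply]
          norm_num [h3, h6]
          rw [if_neg (by omega), hout a]
        all_goals
          simp only [hs₁, Store.setIdx, Store.setMem, Store.get, Function.update_apply]
          norm_num [h1, h2, h3, h4, h6, h7, h8, h12, htot]
        omega
      · constructor
        case flag =>
          have h0 : (s₁.setMem 6 (s₁.get 1 - s₁.get 7)).mem 0 = s.mem 0 := by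
            simp only [hs₁, Store.setIdx, Store.setMem]
            norm_num [h6, Function.update_apply]
            omega
          rw [h0]
          rcases hflag with ⟨h0, hall⟩ | ⟨h0, i, hi, hlt'⟩
          · refine .inl ⟨h0, fun i hi => ?_⟩
            rcases Nat.lt_succ_iff_lt_or_eq.1 hi with hi | rfl
            · exact hall i hi
            · exact hlt
          · exact .inr ⟨h0, i, by omega, hlt'⟩
        case moved =>
          intro i hi
          simp only [hs₁, Store.setIdx, Store.setMem, Store.get, Function.update_apply]
          norm_num [h3, h6]
          rw [if_neg (by omega), hmov i hi]
        case input =>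
          intro a ha ha'
          simp only [hs₁, Store.setIdx, Store.setMem, Store.get, Function.update_apply]
          norm_num [h3, h6]
          rw [if_neg (by omega), hin a ha ha']
        case output =>
          intro a
          simp only [hs₁, Store.setIdx, Store.setMem, Store.get, Function.update_apply]
          norm_num [h3, h6]
          rw [if_neg (by omega), hout a]
        all_goals
          simp only [hs₁, Store.setIdx, Store.setMem, Store.get, Function.update_apply]
          norm_num [h1, h2, h3, h4, h6, h7, h8, h12, htot]
        omega
    refine .seq (c := 1) (c' := 14) (.idxAdd ?_)
    refine .seq (c := 1) (c' := 12) (.idxAdd ?_)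
    refine .seq (c := 1) (c' := 10) (.dataSub ?_)
    refine .seq (c := 2) (c' := 7) (htest.mono le_rfl ?_)
    rintro s ⟨h1, h2, h3, h4, h6, h7, h8, h12, hflag, htot, hmov, hin, hout⟩
    have hz : s.mem (2 + 3 * n) = 0 := by rw [hin _ (by omega) (by omega), hm.zero]
    refine .seq (c := 1) (c' := 5) (.dataAdd ?_)
    refine .seq (c := 1) (c' := 3) (.idxAdd ?_)
    refine .seq (c := 1) (c' := 1) (.idxAdd ?_)
    refine .idxAdd ?_
    constructor
    case flag =>
      have h0 : 0 ≠ 2 + k := by omega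
      simpa [Store.setIdx, Store.setMem, h12, Function.update_apply, h0] using hflag
    case moved =>
      intro i hi
      simp only [Store.setIdx, Store.setMem, Store.get, Function.update_apply]
      norm_num [h4, h7, h12, hz, hout]
      rcases Nat.lt_succ_iff_lt_or_eq.1 hi with hi | rfl
      · rw [if_neg (by omega), hmov i hi]
      · rw [if_pos rfl]
    case input =>
      intro a ha ha'
      simp only [Store.setIdx, Store.setMem, Store.get, Function.update_apply]
      norm_num [h12]
      rw [if_neg (by omega), hin a (by omega) ha']
    case output =>
      intro a
      simp only [Store.setIdx, Store.setMem, Store.get, Function.update_apply]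
      norm_num [h12]
      rw [if_neg (by omega), hout a]
    all_goals
      simp only [Store.setIdx, Store.setMem, Store.get, Function.update_apply]
      norm_num [h1, h2, h3, h4, h6, h7, h8, h12, htot]
    all_goals omega
  · intro s h
    simp [Test.eval, h.idx4, h.idx8]

theorem terminates_starProg (hm : TameInput n B m) {s : Store K} (h0 : s.idx 0 = n)
    (hidx : ∀ r, r ≠ 0 → s.idx r = 0) (hmem : s.mem = m) :
    Terminates B (100 * (n + 1) ^ 3) starProg s fun s' =>
      ∃ out, (∀ i ≤ n, IsLeastDual n m i (out i)) ∧ OutputFrame n n n m out s' := by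
  refine (Terminates.seq ((terminates_setupProg h0 hidx fun a => by rw [hmem]).mono le_rfl
    fun s hs => Terminates.seq ((terminates_worthLoop hm hs).mono le_rfl ?_
      (Q' := fun s' => Terminates B (11 + (n * 17 + 1) + 1) _ s' _)))).mono ?_ fun _ h => h
  · rintro s ⟨out, hF, hout⟩
    exact .seq ((terminates_outputSetupProg hm hF).mono le_rfl fun s hs =>
      (terminates_outputLoop hm hs).mono le_rfl fun s hs => ⟨out, hout, hs⟩)
  · have : 100 * (n + 1) ^ 3 = 100 * n ^ 3 + 300 * n ^ 2 + 300 * n + 100 := by ring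
    rw [this]
    ring_nf
    nlinarith [Nat.zero_le (n ^ 3), Nat.zero_le (n ^ 2)]

end Correctness

end RAM

/-! ### Logarithmic cost of tame runs -/

namespace RAM

/-- `x` is a multiple of `1 / D` of absolute value at most `M`. -/
def IsSmall (D M : ℕ) (x : ℚ) : Prop :=
  (∃ z : ℤ, (D : ℚ) * x = z) ∧ |x| ≤ M

namespace IsSmall

variable {D M M' : ℕ} {x y : ℚ}

theorem mono (h : IsSmall D M x) (hM : M ≤ M') : IsSmall D M' x :=
  ⟨h.1, h.2.trans (by exact_mod_cast hM)⟩

theorem natCast {a : ℕ} (ha : a ≤ M) : IsSmall D M (a : ℚ) :=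
  ⟨⟨D * a, by push_cast; rfl⟩, by rw [Nat.abs_cast]; exact_mod_cast ha⟩

theorem add (hx : IsSmall D M x) (hy : IsSmall D M y) : IsSmall D (M * 2) (x + y) := by
  obtain ⟨⟨z, hz⟩, hx⟩ := hx
  obtain ⟨⟨z', hz'⟩, hy⟩ := hy
  refine ⟨⟨z + z', by rw [mul_add, hz, hz']; push_cast; rfl⟩, (abs_add_le x y).trans ?_⟩
  push_cast
  linarith

theorem sub (hx : IsSmall D M x) (hy : IsSmall D M y) : IsSmall D (M * 2) (x - y) := by
  rw [sub_eq_add_neg]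
  refine hx.add ⟨?_, by rw [abs_neg]; exact hy.2⟩
  obtain ⟨z, hz⟩ := hy.1
  exact ⟨-z, by rw [mul_neg, hz]; push_cast; rfl⟩

theorem natCast_mul {a : ℕ} (ha : a ≤ M') (hx : IsSmall D M x) :
    IsSmall D (M * M') ((a : ℚ) * x) := by
  obtain ⟨⟨z, hz⟩, hx⟩ := hx
  refine ⟨⟨a * z, by rw [mul_left_comm, hz]; push_cast; rfl⟩, ?_⟩
  rw [abs_mul, Nat.abs_cast, mul_comm]
  push_cast
  have : (a : ℚ) ≤ M' := by exact_mod_cast ha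
  gcongr

theorem ratSize_le (hD : 0 < D) (h : IsSmall D M x) :
    ratSize x ≤ 1 + (M * D).size + D.size := by
  obtain ⟨⟨z, hz⟩, hx⟩ := h
  have hD' : (D : ℚ) ≠ 0 := by exact_mod_cast hD.ne'
  have hden : x.den ∣ D := by
    have hxz : x = (z : ℚ) / (D : ℤ) := by
      rw [eq_div_iff (by exact_mod_cast hD'), mul_comm, ← hz]
      push_cast
      rfl
    have := Rat.den_dvd z D
    rw [Rat.divInt_eq_div, ← hxz] at this
    exact_mod_cast this
  have hle : x.den ≤ D := Nat.le_of_dvd hD hden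
  have hnum : x.num.natAbs ≤ M * D := by
    have h1 : (x.num.natAbs : ℚ) = |x| * x.den := by
      rw [Nat.cast_natAbs, Int.cast_abs, ← Rat.mul_den_eq_num, abs_mul, Nat.abs_cast]
    have h2 : (x.num.natAbs : ℚ) ≤ M * D := by
      rw [h1]
      have : (x.den : ℚ) ≤ D := by exact_mod_cast hle
      gcongr
    exact_mod_cast h2
  exact Nat.add_le_add (Nat.add_le_add_left (Nat.size_le_size hnum) 1) (Nat.size_le_size hle)

theorem of_den_dvd (hden : x.den ∣ D) (hx : x.num.natAbs ≤ M) : IsSmall D M x := by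
  obtain ⟨k, rfl⟩ := hden
  refine ⟨⟨k * x.num, ?_⟩, ?_⟩
  · push_cast
    rw [mul_comm (x.den : ℚ), mul_assoc, Rat.den_mul_eq_num]
  · have h1 : |x| ≤ |x| * x.den :=
      le_mul_of_one_le_right (abs_nonneg x) (by exact_mod_cast x.pos)
    have h2 : (x.num.natAbs : ℚ) = |x| * x.den := by
      rw [Nat.cast_natAbs, Int.cast_abs, ← Rat.mul_den_eq_num, abs_mul, Nat.abs_cast]
    rw [← h2] at h1
    exact h1.trans (by exact_mod_cast hx)

end IsSmall

/-- All index registers of `s` are at most `M`, and all data are multiples of `1 / D` of absolute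
value at most `M`. -/
structure SmallStore (D M : ℕ) (s : Store ℚ) : Prop where
  idx : ∀ i, s.idx i ≤ M
  mem : ∀ a, IsSmall D M (s.mem a)

namespace SmallStore

variable {D M M' : ℕ} {s : Store ℚ}

theorem mono (h : SmallStore D M s) (hM : M ≤ M') : SmallStore D M' s :=
  ⟨fun i => (h.idx i).trans hM, fun a => (h.mem a).mono hM⟩

theorem setIdx (h : SmallStore D M s) {i c : ℕ} (hc : c ≤ M) : SmallStore D M (s.setIdx i c) := by
  refine ⟨fun j => ?_, h.mem⟩
  simp only [Store.setIdx, Function.update_apply]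
  split_ifs
  exacts [hc, h.idx j]

theorem setMem (h : SmallStore D M s) {i : ℕ} {x : ℚ} (hx : IsSmall D M x) :
    SmallStore D M (s.setMem i x) := by
  refine ⟨h.idx, fun a => ?_⟩
  simp only [Store.setMem, Function.update_apply]
  split_ifs
  exacts [hx, h.mem a]

end SmallStore

variable {A B D M : ℕ} {c : Config ℚ}

/-- A tame step multiplies the bound on the store by at most `A`. -/
theorem SmallStore.step (hA : 8 ≤ A) (hB : B ≤ A) (hM : A ≤ M) (h : SmallStore D M c.store)
    (ht : TameStep B c) : SmallStore D (M * A) (step c).store := by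
  have hMA : M ≤ M * A := Nat.le_mul_of_pos_right M (by omega)
  have h2 : M * 2 ≤ M * A := Nat.mul_le_mul_left M (by omega)
  have h' := h.mono hMA
  obtain ⟨todo, s⟩ := c
  rcases todo with _ | ⟨P, r⟩
  · exact h'
  cases P with
  | skip | seq | ite => exact h'
  | loop t P =>
    simp only [RAM.step]
    split_ifs <;> exact h'
  | idxConst i a =>
    have ha : a ≤ 7 := ht
    exact h'.setIdx (by omega)
  | idxAdd i j k =>
    have hj : s.idx j ≤ M := h.idx j
    have hk : s.idx k ≤ M := h.idx k
    exact h'.setIdx (show s.idx j + s.idx k ≤ M * A by omega)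
  | idxSub i j k =>
    have hj : s.idx j ≤ M := h.idx j
    exact h'.setIdx (show s.idx j - s.idx k ≤ M * A by omega)
  | dataConst i a =>
    have ha : a ≤ 7 := ht
    exact h'.setMem (IsSmall.natCast (by omega))
  | dataAdd i j k => exact h'.setMem (((h.mem _).add (h.mem _)).mono h2)
  | dataSub i j k => exact h'.setMem (((h.mem _).sub (h.mem _)).mono h2)
  | dataMul i j k =>
    obtain ⟨m, hm, hj⟩ := ht
    refine h'.setMem ?_
    change s.get j = m at hj
    rw [hj]
    exact (h.mem _).natCast_mul (hm.trans hB)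

theorem stepCost_le (hD : 0 < D) (hA : 8 ≤ A) (hB : B ≤ A) (hM : A ≤ M)
    (h : SmallStore D M c.store) (ht : TameStep B c) :
    stepCost c ≤ 1 + 6 * (1 + (M * A * D).size + D.size) := by
  have hMA : M ≤ M * A := Nat.le_mul_of_pos_right M (by omega)
  have h2 : M * 2 ≤ M * A := Nat.mul_le_mul_left M (by omega)
  have hMAD : M * A ≤ M * A * D := Nat.le_mul_of_pos_right _ hD
  set R := 1 + (M * A * D).size + D.size with hR
  have hsize : ∀ {a : ℕ}, a ≤ M * A → a.size ≤ R := fun {a} ha => by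
    have := Nat.size_le_size (ha.trans hMAD)
    omega
  have hrat : ∀ {x : ℚ}, IsSmall D (M * A) x → ratSize x ≤ R := fun hx => hx.ratSize_le hD
  have hi : ∀ i, idxBits c.store i ≤ R := fun i => hsize ((h.idx i).trans hMA)
  have hc : ∀ i, cellBits c.store i ≤ 2 * R := fun i => by
    have h1 := hi i
    have h3 : ratSize (c.store.get i) ≤ R := hrat ((h.mem _).mono hMA)
    rw [cellBits]
    omega
  have htest : ∀ t : Test, t.bits c.store ≤ 4 * R := by
    rintro (⟨i, j⟩ | ⟨i, j⟩ | ⟨i, j⟩ | ⟨i, j⟩) <;> simp only [Test.bits] <;>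
      have h1 := hi i <;> have h3 := hi j <;> have h5 := hc i <;> have h7 := hc j <;> omega
  obtain ⟨todo, s⟩ := c
  rcases todo with _ | ⟨P, r⟩
  · exact Nat.zero_le _
  cases P with
  | skip | seq => exact Nat.le_add_right _ _
  | ite t P Q =>
    have := htest t
    simp only [stepCost] at this ⊢
    omega
  | loop t P =>
    have := htest t
    simp only [stepCost] at this ⊢
    omega
  | idxConst i a =>
    have ha : a ≤ 7 := ht
    have := hsize (a := a) (by omega)
    simp only [stepCost]
    omega
  | idxAdd i j k =>
    have hj := hi j
    have hk := hi k
    have hj' := h.idx j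
    have hk' := h.idx k
    simp only [stepCost] at hj hk hj' hk' ⊢
    have := hsize (a := s.idx j + s.idx k) (by omega)
    omega
  | idxSub i j k =>
    have hj := hi j
    have hk := hi k
    have hj' := h.idx j
    simp only [stepCost] at hj hk hj' ⊢
    have := hsize (a := s.idx j - s.idx k) (by omega)
    omega
  | dataConst i a =>
    have ha : a ≤ 7 := ht
    have h1 := hi i
    have := hrat (IsSmall.natCast (D := D) (a := a) (M := M * A) (by omega))
    simp only [stepCost] at h1 ⊢
    omega
  | dataAdd i j k =>
    have h1 := hi i
    have hj := hc j
    have hk := hc k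
    have : ratSize (s.get j + s.get k) ≤ R := hrat (((h.mem _).add (h.mem _)).mono h2)
    simp only [stepCost] at h1 hj hk ⊢
    omega
  | dataSub i j k =>
    have h1 := hi i
    have hj := hc j
    have hk := hc k
    have : ratSize (s.get j - s.get k) ≤ R := hrat (((h.mem _).sub (h.mem _)).mono h2)
    simp only [stepCost] at h1 hj hk ⊢
    omega
  | dataMul i j k =>
    obtain ⟨m, hm, hm'⟩ := ht
    have h1 := hi i
    have hj := hc j
    have hk := hc k
    have : ratSize (s.get j * s.get k) ≤ R := by
      change s.get j = m at hm'
      rw [hm']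
      exact hrat ((h.mem _).natCast_mul (hm.trans hB))
    simp only [stepCost] at h1 hj hk ⊢
    omega

/-- A tame run of polynomial length has polynomial logarithmic cost: after `t` steps the store is
bounded by `2 ^ ((L + 3) * (t + 1))`. -/
theorem bitCost_le {P : Prog} {s : Store ℚ} {T L : ℕ} (hD : 0 < D) (hDL : D ≤ 2 ^ L)
    (hs : SmallStore D (2 ^ L) s) (ht : ∀ t < T, TameStep (2 ^ L) (run P s t)) :
    bitCost P s T ≤ T * (1 + 6 * ((L + 3) * (T + 4))) := by
  have hL : 2 ^ L ≤ 2 ^ (L + 3) := Nat.pow_le_pow_right (by norm_num) (by omega)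
  have h8 : 8 ≤ 2 ^ (L + 3) := by
    rw [pow_add]
    have := Nat.one_le_two_pow (n := L)
    omega
  have hM : ∀ t, 2 ^ (L + 3) ≤ 2 ^ ((L + 3) * (t + 1)) := fun t =>
    Nat.pow_le_pow_right (by norm_num) (Nat.le_mul_of_pos_right _ (by omega))
  have hsmall : ∀ t ≤ T, SmallStore D (2 ^ ((L + 3) * (t + 1))) (run P s t).store := by
    intro t
    induction t with
    | zero =>
      intro _
      exact hs.mono (by simpa using hL)
    | succ t ih =>
      intro htT
      have := (ih (by omega)).step h8 hL (hM t) (ht t (by omega))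
      rwa [← pow_add, ← Nat.mul_succ, run, ← Function.iterate_succ_apply' RAM.step] at this
  have hcost : ∀ t ∈ Finset.range T, stepCost (run P s t) ≤ 1 + 6 * ((L + 3) * (T + 4)) := by
    intro t htT
    rw [Finset.mem_range] at htT
    have h := stepCost_le hD h8 hL (hM t) (hsmall t htT.le) (ht t htT)
    have h1 : (2 ^ ((L + 3) * (t + 1)) * 2 ^ (L + 3) * D).size ≤ (L + 3) * (t + 2) + L + 1 := by
      rw [Nat.size_le, ← pow_add]
      calc _ ≤ 2 ^ ((L + 3) * (t + 1) + (L + 3)) * 2 ^ L := Nat.mul_le_mul_left _ hDL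
        _ < _ := by
          rw [← pow_add]
          exact Nat.pow_lt_pow_right (by norm_num) (by ring_nf; omega)
    have h2 : D.size ≤ L + 1 := by
      rw [Nat.size_le]
      exact hDL.trans_lt (Nat.pow_lt_pow_right (by norm_num) (by omega))
    have h3 : (L + 3) * (t + 2) + (L + 3) * 2 ≤ (L + 3) * (T + 4) := by
      rw [← mul_add]
      exact Nat.mul_le_mul_left _ (by omega)
    omega
  calc bitCost P s T ≤ ∑ _t ∈ Finset.range T, (1 + 6 * ((L + 3) * (T + 4))) :=
        Finset.sum_le_sum hcost
    _ = _ := by rw [Finset.sum_const, Finset.card_range, smul_eq_mul]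

end RAM

/-! ### The input and the output of the program -/

section Input

variable {K : Type*} [CommRing K] {n : ℕ} (w : Fin n → K) (b : Unit ⊕ Fin n → ℕ)
  (p : Unit ⊕ Fin n → K)

theorem starInput_mem_weight (j : ℕ) :
    (starInput n w b p).mem (2 + 3 * j) = if h : j < n then w ⟨j, h⟩ else 0 := by
  rw [add_comm]
  simp [starInput]

theorem starInput_mem_cap (j : ℕ) : (starInput n w b p).mem (3 + 3 * j) =
    if h : j < n then (b (Sum.inr ⟨j, h⟩) : K) else 0 := by
  rw [show 3 + 3 * j = 3 * j + 1 + 2 by ring]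
  simp [starInput, Nat.add_mod, show (3 * j + 1) / 3 = j by omega]

theorem starInput_mem_share (j : ℕ) : (starInput n w b p).mem (4 + 3 * j) =
    if h : j < n then p (Sum.inr ⟨j, h⟩) else 0 := by
  rw [show 4 + 3 * j = 3 * j + 2 + 2 by ring]
  simp [starInput, Nat.add_mod, show (3 * j + 2) / 3 = j by omega]

/-- Every cell of the input holds zero, a capacity, a weight or a share. -/
theorem starInput_mem_induction {C : K → Prop} (h0 : C 0) (hb : ∀ a, C (b a)) (hw : ∀ i, C (w i))
    (hp : ∀ a, C (p a)) (a : ℕ) : C ((starInput n w b p).mem a) := by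
  match a with
  | 0 => exact hb _
  | 1 => exact hp _
  | a + 2 =>
    simp only [starInput]
    split
    · split
      exacts [hw _, hb _, hp _]
    · exact h0

theorem tameInput_starInput {B : ℕ} (hB : ∀ a, b a ≤ B) :
    RAM.TameInput n B (starInput n w b p).mem := by
  refine ⟨by simp [starInput_mem_weight], ⟨b (Sum.inl ()), hB _, rfl⟩, fun j _ => ?_⟩
  rw [starInput_mem_cap]
  split_ifs with h
  · exact ⟨_, hB _, rfl⟩
  · exact ⟨0, Nat.zero_le _, by simp⟩

end Input

namespace RAM

section Result

variable {K : Type*} [CommRing K] [LinearOrder K]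

/-- The memory `mem` holds the results computed by the program on the input cells `m`. -/
def IsResult (n : ℕ) (m mem : ℕ → K) : Prop :=
  ∃ out : ℕ → K, (∀ i ≤ n, IsLeastDual n m i (out i)) ∧
    ((mem 0 = 1 ∧ ∀ i < n, m (4 + 3 * i) ≤ out n - out i) ∨
      (mem 0 = 0 ∧ ∃ i < n, out n - out i < m (4 + 3 * i))) ∧
    mem 1 = out n ∧ ∀ i < n, mem (2 + i) = out i

/-- The program run on an encoded star game: it halts in time, with the right result cells, and all
its steps are tame. -/
theorem exists_run_starProg {n B : ℕ} (w : Fin n → K) {b : Unit ⊕ Fin n → ℕ}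
    (p : Unit ⊕ Fin n → K) (hB : ∀ a, b a ≤ B) :
    ∃ T ≤ 100 * (n + 1) ^ 3, HaltedAt starProg (starInput n w b p) T ∧
      IsResult n (starInput n w b p).mem (run starProg (starInput n w b p) T).store.mem ∧
      ∀ t < T, TameStep B (run starProg (starInput n w b p) t) := by
  obtain ⟨T, hT, s', ⟨out, hout, hs'⟩, hr⟩ :=
    terminates_starProg (tameInput_starInput w b p hB) (s := starInput n w b p)
      (by simp [starInput]) (fun r hr => by simp [starInput, hr]) rfl
  obtain ⟨hrun, htame⟩ := hr []
  refine ⟨T, hT, ?_, ?_, htame⟩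
  · rw [HaltedAt, run, hrun]
  · rw [run, hrun]
    exact ⟨out, hout, hs'.flag, hs'.total, hs'.moved⟩

end Result

theorem cast_dualCell (n : ℕ) (m : ℕ → ℚ) (i l : ℕ) :
    ((dualCell n m i l : ℚ) : ℝ) = dualCell n (fun a => (m a : ℝ)) i l := by
  simp only [dualCell, Rat.cast_add, Rat.cast_mul, Rat.cast_sum, Rat.cast_lt]
  congr 1
  refine Finset.sum_congr rfl fun j _ => ?_
  split_ifs <;> push_cast <;> rfl

theorem IsLeastDual.cast {n i : ℕ} {m : ℕ → ℚ} {v : ℚ} (h : IsLeastDual n m i v) :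
    IsLeastDual n (fun a => (m a : ℝ)) i (v : ℝ) := by
  obtain ⟨hle, l, hl, hv⟩ := h
  refine ⟨fun l hl => ?_, l, hl, ?_⟩
  · rw [← cast_dualCell]
    exact_mod_cast hle l hl
  · rw [← cast_dualCell, hv]

theorem IsResult.cast {n : ℕ} {m mem : ℕ → ℚ} (h : IsResult n m mem) :
    IsResult n (fun a => (m a : ℝ)) (fun a => (mem a : ℝ)) := by
  obtain ⟨out, hout, hflag, htot, hmov⟩ := h
  refine ⟨fun i => out i, fun i hi => (hout i hi).cast, ?_, by simp [htot], fun i hi => by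
    simp [hmov i hi]⟩
  beta_reduce
  exact_mod_cast hflag

end RAM

theorem cast_starInput_mem {n : ℕ} (w : Fin n → ℚ) (b : Unit ⊕ Fin n → ℕ)
    (p : Unit ⊕ Fin n → ℚ) (a : ℕ) : (((starInput n w b p).mem a : ℚ) : ℝ) =
      (starInput n (fun i => (w i : ℝ)) b fun i => (p i : ℝ)).mem a := by
  match a with
  | 0 => simp [starInput]
  | 1 => simp [starInput]
  | a + 2 =>
    simp only [starInput]
    split
    · split <;> simp
    · simp

namespace StarGame

variable {n : ℕ} {w : Fin n → ℝ} {b : Unit ⊕ Fin n → ℕ} {p : Unit ⊕ Fin n → ℝ}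

theorem dualCell_starInput (i l : ℕ) :
    RAM.dualCell n (starInput n w b p).mem i l =
      dualValue w b (Finset.univ.filter fun j : Fin n => (j : ℕ) ≠ i)
        ((starInput n w b p).mem (2 + 3 * l)) := by
  -- The additional leaf `n` has capacity zero, so its term vanishes.
  have hlast : (starInput n w b p).mem (3 + 3 * n) = 0 := by simp [starInput_mem_cap]
  rw [RAM.dualCell, dualValue, Finset.sum_range_succ, hlast, zero_mul, ite_self, add_zero,
    Finset.sum_range, Finset.sum_filter, mul_comm]
  refine congrArg₂ _ rfl (Finset.sum_congr rfl fun j _ => ?_)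
  rw [starInput_mem_weight w b p j, starInput_mem_cap, dif_pos j.2, dif_pos j.2]
  by_cases hj : (j : ℕ) = i
  · simp [hj]
  rcases lt_or_ge ((starInput n w b p).mem (2 + 3 * l)) (w j) with h | h
  · simp [hj, h, h.le]
  · simp [hj, h, h.not_gt]

theorem IsLeastDual.eq_leafWorth (hw : ∀ j, 0 ≤ w j) {i : ℕ} {v : ℝ}
    (h : RAM.IsLeastDual n (starInput n w b p).mem i v) :
    v = leafWorth w b (Finset.univ.filter fun j : Fin n => (j : ℕ) ≠ i) := by
  obtain ⟨hle, l, -, hv⟩ := h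
  apply le_antisymm
  · obtain ⟨c, hc, -, heq⟩ := exists_leafWorth_eq_dualValue hw b
      (Finset.univ.filter fun j : Fin n => (j : ℕ) ≠ i)
    rw [heq]
    rcases hc with rfl | ⟨j, rfl⟩
    -- Price zero is the weight of the additional leaf `n`.
    · simpa [dualCell_starInput, starInput_mem_weight] using hle n le_rfl
    · simpa [dualCell_starInput, starInput_mem_weight] using hle j j.2.le
  · rw [hv, dualCell_starInput]
    refine leafWorth_le_dualValue w b _ ?_
    rw [starInput_mem_weight]
    split_ifs
    exacts [hw _, le_rfl]

/-- The result cell of leaf `i` holds the worth without that leaf; no leaf has the index `n`, so the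
cell of `n` holds the worth of the whole game. -/
theorem isCorrectOutput_of_isResult (hw : ∀ j, 0 ≤ w j)
    (hp : IsImputation (starGraph n w b).worth p) {mem : ℕ → ℝ}
    (h : RAM.IsResult n (starInput n w b p).mem mem) : IsCorrectOutput n w b p mem := by
  obtain ⟨out, hout, hflag, htot, hmov⟩ := h
  have hn : out n = (starGraph n w b).worth Finset.univ := by
    rw [IsLeastDual.eq_leafWorth hw (hout n le_rfl), worth_univ_eq,
      Finset.filter_true_of_mem fun j _ => j.2.ne]
  have hi : ∀ i : Fin n, out i = (starGraph n w b).worth (Finset.univ.erase (Sum.inr i)) := by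
    intro i
    rw [IsLeastDual.eq_leafWorth hw (hout i i.2.le), worth_erase_eq]
    congr 1
    ext j
    simp [Fin.ext_iff]
  have hcore := mem_gameCore_iff hw hp
  have hshare : ∀ i : Fin n, (starInput n w b p).mem (4 + 3 * i) = p (Sum.inr i) := fun i => by
    simp [starInput_mem_share]
  refine ⟨fun h => ?_, fun h => ?_, htot.trans hn, fun i => (hmov i i.2).trans (hi i)⟩
  · rcases hflag with ⟨h0, -⟩ | ⟨-, i, hin, hlt⟩
    · exact h0
    · have := hcore.1 h ⟨i, hin⟩
      rw [marginalUtility, ← hn, ← hi, ← hshare] at this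
      exact absurd hlt this.not_gt
  · rcases hflag with ⟨-, hle⟩ | ⟨h0, -⟩
    · refine absurd (hcore.2 fun i => ?_) h
      rw [marginalUtility, ← hn, ← hi, ← hshare]
      exact hle i i.2
    · exact h0

end StarGame

/-! ### Binary length of the input -/

section Size

variable {n : ℕ} (w : Fin n → ℚ) (b : Unit ⊕ Fin n → ℕ) (p : Unit ⊕ Fin n → ℚ)

theorem ratSize_le_starInputSize (i : Fin n) :
    RAM.ratSize (w i) + RAM.ratSize (b (Sum.inr i) : ℚ) + RAM.ratSize (p (Sum.inr i)) ≤
      starInputSize n w b p :=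
  le_add_left (Finset.single_le_sum (f := fun i =>
    RAM.ratSize (w i) + RAM.ratSize (b (Sum.inr i) : ℚ) + RAM.ratSize (p (Sum.inr i)))
    (fun _ _ => Nat.zero_le _) (Finset.mem_univ i))

theorem ratSize_weight_le (i : Fin n) : RAM.ratSize (w i) ≤ starInputSize n w b p := by
  have := ratSize_le_starInputSize w b p i
  omega

theorem ratSize_cap_le (a : Unit ⊕ Fin n) : RAM.ratSize (b a : ℚ) ≤ starInputSize n w b p := by
  rcases a with _ | i
  · change RAM.ratSize (b (Sum.inl ()) : ℚ) ≤ _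
    rw [starInputSize]
    omega
  · have := ratSize_le_starInputSize w b p i
    omega

theorem ratSize_share_le (a : Unit ⊕ Fin n) : RAM.ratSize (p a) ≤ starInputSize n w b p := by
  rcases a with _ | i
  · change RAM.ratSize (p (Sum.inl ())) ≤ _
    rw [starInputSize]
    omega
  · have := ratSize_le_starInputSize w b p i
    omega

theorem le_starInputSize : n ≤ starInputSize n w b p := by
  refine le_add_left ?_
  calc n = ∑ _i : Fin n, 1 := by simp
    _ ≤ _ := Finset.sum_le_sum fun i _ => by simp only [RAM.ratSize]; omega

theorem natAbs_num_le_two_pow {x : ℚ} {L : ℕ} (h : RAM.ratSize x ≤ L) : x.num.natAbs ≤ 2 ^ L :=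
  (Nat.size_le.1 (by rw [RAM.ratSize] at h; omega)).le

theorem cap_le_two_pow (a : Unit ⊕ Fin n) : b a ≤ 2 ^ starInputSize n w b p := by
  simpa using natAbs_num_le_two_pow (ratSize_cap_le w b p a)

/-- A common denominator of all weights and shares. -/
def commonDen : ℕ :=
  (p (Sum.inl ())).den * ∏ i, (w i).den * (p (Sum.inr i)).den

theorem commonDen_pos : 0 < commonDen w p :=
  Nat.mul_pos (Rat.den_pos _) (Finset.prod_pos fun _ _ => Nat.mul_pos (Rat.den_pos _) (Rat.den_pos _))

theorem commonDen_le : commonDen w p ≤ 2 ^ starInputSize n w b p := by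
  have hden : ∀ x : ℚ, x.den ≤ 2 ^ RAM.ratSize x := fun x =>
    (Nat.size_le.1 (by rw [RAM.ratSize]; omega)).le
  rw [commonDen]
  calc _ ≤ 2 ^ RAM.ratSize (p (Sum.inl ())) *
        ∏ i, 2 ^ (RAM.ratSize (w i) + RAM.ratSize (p (Sum.inr i))) := by
        refine Nat.mul_le_mul (hden _) (Finset.prod_le_prod' fun i _ => ?_)
        rw [pow_add]
        exact Nat.mul_le_mul (hden _) (hden _)
    _ ≤ _ := by
        rw [Finset.prod_pow_eq_pow_sum, ← pow_add]
        refine Nat.pow_le_pow_right (by norm_num) (Nat.add_le_add (Nat.le_add_left _ _)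
          (Finset.sum_le_sum fun i _ => ?_))
        omega

theorem smallStore_starInput :
    RAM.SmallStore (commonDen w p) (2 ^ starInputSize n w b p) (starInput n w b p) := by
  refine ⟨fun i => ?_, starInput_mem_induction w b p ?_ ?_ ?_ ?_⟩
  · simp only [starInput]
    split_ifs
    · exact (le_starInputSize w b p).trans Nat.lt_two_pow_self.le
    · exact Nat.zero_le _
  · exact_mod_cast RAM.IsSmall.natCast (Nat.zero_le _)
  · exact fun a => RAM.IsSmall.natCast (cap_le_two_pow w b p a)
  · refine fun i => .of_den_dvd ?_ (natAbs_num_le_two_pow (ratSize_weight_le w b p i))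
    exact ((Nat.dvd_mul_right _ _).trans (Finset.dvd_prod_of_mem
      (fun i => (w i).den * (p (Sum.inr i)).den) (Finset.mem_univ i))).trans (Nat.dvd_mul_left _ _)
  · refine fun a => .of_den_dvd ?_ (natAbs_num_le_two_pow (ratSize_share_le w b p a))
    rcases a with _ | i
    · exact Nat.dvd_mul_right _ _
    · exact ((Nat.dvd_mul_left _ _).trans (Finset.dvd_prod_of_mem
        (fun i => (w i).den * (p (Sum.inr i)).den) (Finset.mem_univ i))).trans
        (Nat.dvd_mul_left _ _)

end Size

theorem mainTheorem6 :
    ∃ (P : RAM.Prog) (q r : Polynomial ℕ),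
      (∀ (n : ℕ) (w : Fin n → ℝ) (b : Unit ⊕ Fin n → ℕ) (p : Unit ⊕ Fin n → ℝ),
        (∀ i, 0 ≤ w i) → IsImputation (starGraph n w b).worth p →
        (p ∈ gameCore (starGraph n w b).worth ↔
          ∀ i : Fin n, p (Sum.inr i) ≤ marginalUtility (starGraph n w b).worth (Sum.inr i)) ∧
        ∃ T ≤ q.eval n,
          RAM.HaltedAt P (starInput n w b p) T ∧
          IsCorrectOutput n w b p (RAM.run P (starInput n w b p) T).store.mem) ∧
      (∀ (n : ℕ) (w : Fin n → ℚ) (b : Unit ⊕ Fin n → ℕ) (p : Unit ⊕ Fin n → ℚ),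
        (∀ i, 0 ≤ w i) →
        IsImputation (starGraph n (fun i => (w i : ℝ)) b).worth (fun i => (p i : ℝ)) →
        ∃ T ≤ q.eval n,
          RAM.HaltedAt P (starInput n w b p) T ∧
          IsCorrectOutput n (fun i => (w i : ℝ)) b (fun i => (p i : ℝ))
            (fun a => ((RAM.run P (starInput n w b p) T).store.mem a : ℝ)) ∧
          RAM.bitCost P (starInput n w b p) T ≤ r.eval (starInputSize n w b p)) := by
  open Polynomial in
  refine ⟨RAM.starProg, 100 * (X + 1) ^ 3,
    100 * (X + 1) ^ 3 * (1 + 6 * ((X + 3) * (100 * (X + 1) ^ 3 + 4))), ?_, ?_⟩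
  · intro n w b p hw hp
    obtain ⟨T, hT, hhalt, hres, -⟩ := RAM.exists_run_starProg (B := ∑ a, b a) w p fun a =>
      Finset.single_le_sum (fun _ _ => Nat.zero_le _) (Finset.mem_univ a)
    exact ⟨StarGame.mem_gameCore_iff hw hp, T, by simpa using hT, hhalt,
      StarGame.isCorrectOutput_of_isResult hw hp hres⟩
  · intro n w b p hw hp
    obtain ⟨T, hT, hhalt, hres, htame⟩ := RAM.exists_run_starProg w p (cap_le_two_pow w b p)
    have hres' := hres.cast
    simp only [cast_starInput_mem] at hres'
    refine ⟨T, by simpa using hT, hhalt, StarGame.isCorrectOutput_of_isResult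
      (fun i => by exact_mod_cast hw i) hp hres', ?_⟩
    refine (RAM.bitCost_le (commonDen_pos w p) (commonDen_le w b p)
      (smallStore_starInput w b p) htame).trans ?_
    have hTL : T ≤ 100 * (starInputSize n w b p + 1) ^ 3 := by
      refine hT.trans ?_
      have := le_starInputSize w b p
      gcongr
    simp only [eval_mul, eval_add, eval_pow, eval_X, eval_one, eval_ofNat]
    gcongr
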